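/- **Setting.** There are $N$ cellular users (CUs) and $K$ device-to-device (D2D) pairs. Each D2D receiver has $M$ antennas. Pilots are the columns $\omega_1,\dots,\omega_\tau$ of a matrix with $\Omega^H\Omega=I_\tau$, $\tau>N$; CU $n$ uses $\omega_n$, and D2D pair $i$ uses a pilot $\lambda_i\in\{\omega_{N+1},\dots,\omega_\tau\}$. Let $\mathcal X_i$ be the set of D2D pairs with the same pilot as pair $i$ (including $i$). Pilot powers $p_{\mathrm p,i},q_{\mathrm p,n}$, data powers $p_{\mathrm s,i},q_{\mathrm s,n}$ and large-scale fading coefficients $v_{ik}^{(d)},v_{nk}^{(c)}$ (to D2D receiver $k$) are nonnegative reals, and $N_0>0$. For each receiver $k$, the channels $g_{ik}^{(d)},g_{nk}^{(c)}\sim\mathcal{CN}(0,I_M)$ and the $M\times\tau$ noise matrix $N_k$ with i.i.d. $\mathcal{CN}(0,N_0)$ entries are independent. The received pilot matrix is $$Y_k=\sum_{n=1}^N\sqrt{q_{\mathrm p,n}v_{nk}^{(c)}}\,g_{nk}^{(c)}\omega_n^H+\sum_{i=1}^K\sqrt{p_{\mathrm p,i}v_{ik}^{(d)}}\,g_{ik}^{(d)}\lambda_i^H+N_k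 ,$$ and the MMSE channel estimates are $$\hat g_{ik}^{(d)}=\frac{\sqrt{p_{\mathrm p,i}v_{ik}^{(d)}}}{\sum_{j\in\mathcal X_i}p_{\mathrm p,j}v_{jk}^{(d)}+N_0}Y_k\lambda_i,\qquad \hat g_{nk}^{(c)}=\frac{\sqrt{q_{\mathrm p,n}v_{nk}^{(c)}}}{q_{\mathrm p,n}v_{nk}^{(c)}+N_0}Y_k\omega_n .$$ Put $$\mu_{ik}^{(d)}=\frac{p_{\mathrm p,i}v_{ik}^{(d)}}{\sum_{j\in\mathcal X_i}p_{\mathrm p,j}v_{jk}^{(d)}+N_0},\quad \mu_{nk}^{(c)}=\frac{q_{\mathrm p,n}v_{nk}^{(c)}}{q_{\mathrm p,n}v_{nk}^{(c)}+N_0},\quad \epsilon_{ik}^{(d)}=1-\mu_{ik}^{(d)},\quad \epsilon_{nk}^{(c)}=1-\mu_{nk}^{(c)}.$$ **Receivers.** Let $m_c,m_d\in\mathbb N$ with $m_c+m_d\le M-1$. Receiver $k$ cancels an arbitrary fixed set of $m_c$ CUs, and all D2D transmitters that use one of $m_d$ arbitrary fixed D2D pilots different from $\lambda_k$ (so $m_c\le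 N$ and $m_d\le\tau-N-1$). Let $\mathcal C_k,\mathcal D_k$ be the sets of uncancelled CUs and D2D transmitters; thus $\mathcal X_k\subseteq\mathcal D_k$. The partial zero forcing (PZF) filter $\beta_k$ is the normalized projection of $\hat g_{kk}^{(d)}$ onto the orthogonal complement of the span of the estimated channels $\hat g_{nk}^{(c)}$ $(n\notin\mathcal C_k)$ and $\hat g_{ik}^{(d)}$ $(i\notin\mathcal D_k)$ (and $\beta_k=0$ if that projection vanishes). The effective SINR of D2D link $k$ is $$\eta_k=\frac{p_{\mathrm s,k}v_{kk}^{(d)}|\beta_k^H\hat g_{kk}^{(d)}|^2}{\sum_{i\in\mathcal D_k\setminus k}p_{\mathrm s,i}v_{ik}^{(d)}|\beta_k^H\hat g_{ik}^{(d)}|^2+\sum_{n\in\mathcal C_k}q_{\mathrm s,n}v_{nk}^{(c)}|\beta_k^H\hat g_{nk}^{(c)}|^2+\alpha_k\|\beta_k\|_2^2},$$ $$\alpha_k=\sum_{i=1}^Kp_{\mathrm s,i}v_{ik}^{(d)}\epsilon_{ik}^{(d)}+\sum_{n=1}^Nq_{\mathrm s,n}v_{nk}^{(c)}\epsilon_{nk}^{(c)}+N_0$$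 (with $\eta_k=0$ if $\beta_k=0$). With a coherence interval of length $T\ge\tau$, the instantaneous rate of link $k$ is $R_k=(1-\tau/T)\log_2(1+\eta_k)$, and its ergodic rate is $\mathbb E\{R_k\}$. **Theorem.** For every $k\in\{1,\dots,K\}$, $R_k$ is integrable and $$\mathbb E\{R_k\}\ \ge\ \Big(1-\frac{\tau}{T}\Big)\log_2\!\big(1+\eta_k^{(d,lb)}\big),\qquad \eta_k^{(d,lb)}=\frac{p_{\mathrm s,k}\phi_k^{(d)}}{\sum_{i=1}^Kp_{\mathrm s,i}\psi_{ik}^{(d)}+\sigma_k^{(d)}},$$ where $$\phi_k^{(d)}=(M-m_c-m_d-1)\,v_{kk}^{(d)}\mu_{kk}^{(d)},$$ $$\psi_{ik}^{(d)}=\begin{cases}v_{ik}^{(d)}, & i\in\mathcal D_k\setminus\mathcal X_k,\\ v_{ik}^{(d)}\epsilon_{ik}^{(d)}, & i=k\text{ or }i\notin\mathcal D_k,\\ (M-m_c-m_d-1)\,v_{ik}^{(d)}\mu_{ik}^{(d)}+v_{ik}^{(d)}\epsilon_{ik}^{(d)}, & i\in\mathcal X_k\setminus\{k\},\end{cases}$$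 $$\sigma_k^{(d)}=\sum_{n\in\mathcal C_k}q_{\mathrm s,n}v_{nk}^{(c)}+\sum_{n\notin\mathcal C_k}q_{\mathrm s,n}v_{nk}^{(c)}\epsilon_{nk}^{(c)}+N_0 .$$ -/

import Mathlib

open MeasureTheory ProbabilityTheory
open scoped NNReal Matrix

noncomputable section

namespace D2D

/-- The circularly symmetric complex normal law with mean zero and variance `v`: real and
imaginary parts are independent real Gaussians of variance `v / 2`. -/
def complexNormal (v : ℝ≥0) : Measure ℂ :=
  ((gaussianReal 0 (v / 2)).prod (gaussianReal 0 (v / 2))).map fun p => Complex.mk p.1 p.2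

/-- The law of a vector in `ℂ ^ M` with independent coordinates, each complex normal with mean
zero and variance `v`, that is, with covariance matrix `v • 1`. -/
def complexNormalVec (M : ℕ) (v : ℝ≥0) : Measure (EuclideanSpace ℂ (Fin M)) :=
  (Measure.pi fun _ : Fin M => complexNormal v).map (WithLp.toLp 2)

/-- The deterministic data of the network, with `N` cellular users (CUs), `K` D2D pairs, `M`
antennas at each D2D receiver and pilots of length `τ`. Pilots are the columns of `pilotMatrix`;
CU `n` uses column `n`, D2D pair `i` uses column `pilot i`, one of the last `τ - N` columns. -/
structure System (N K M τ : ℕ) where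
  N_lt : N < τ
  pilotMatrix : Matrix (Fin τ) (Fin τ) ℂ
  pilotMatrix_orthonormal : pilotMatrixᴴ * pilotMatrix = 1
  pilot : Fin K → Fin τ
  le_pilot : ∀ i, N ≤ (pilot i : ℕ)
  /-- `vD i k`: large-scale fading coefficient from D2D transmitter `i` to D2D receiver `k`. -/
  vD : Fin K → Fin K → ℝ
  vD_nonneg : ∀ i k, 0 ≤ vD i k
  /-- `vC n k`: large-scale fading coefficient from CU `n` to D2D receiver `k`. -/
  vC : Fin N → Fin K → ℝ
  vC_nonneg : ∀ n k, 0 ≤ vC n k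
  /-- Pilot transmit power of D2D transmitter `i`. -/
  pp : Fin K → ℝ
  pp_nonneg : ∀ i, 0 ≤ pp i
  /-- Data transmit power of D2D transmitter `i`. -/
  ps : Fin K → ℝ
  ps_nonneg : ∀ i, 0 ≤ ps i
  /-- Pilot transmit power of CU `n`. -/
  qp : Fin N → ℝ
  qp_nonneg : ∀ n, 0 ≤ qp n
  /-- Data transmit power of CU `n`. -/
  qs : Fin N → ℝ
  qs_nonneg : ∀ n, 0 ≤ qs n
  /-- Noise variance. -/
  N0 : ℝ
  N0_pos : 0 < N0

/-- What the receivers cancel: receiver `k` uses `mc` degrees of freedom for the `mc` CUs in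
`cus k`, and `md` degrees of freedom for the D2D transmitters that use one of the `md` pilots in
`pilots k`; these are D2D pilots other than the pilot of pair `k`. -/
structure Cancellation {N K M τ : ℕ} (s : System N K M τ) (mc md : ℕ) where
  cus : Fin K → Finset (Fin N)
  card_cus : ∀ k, (cus k).card = mc
  pilots : Fin K → Finset (Fin τ)
  card_pilots : ∀ k, (pilots k).card = md
  le_of_mem_pilots : ∀ k, ∀ t ∈ pilots k, N ≤ (t : ℕ)
  pilot_notMem : ∀ k, s.pilot k ∉ pilots k

variable {N K M τ : ℕ} (s : System N K M τ)

namespace System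

/-- The pilot of CU `n`. -/
def cuPilot (n : Fin N) : Fin τ := Fin.castLE s.N_lt.le n

/-- The pilot vector with index `t`, i.e. column `t` of the pilot matrix. -/
def pilotVec (t : Fin τ) : Fin τ → ℂ := fun j => s.pilotMatrix j t

/-- The set of D2D pairs that use the same pilot as pair `k` (including `k`). -/
def sharing (k : Fin K) : Finset (Fin K) := Finset.univ.filter fun i => s.pilot i = s.pilot k

/-- `∑ p_{p,j} v_{jk} + N₀` over the D2D pairs `j` that use the same pilot as pair `i`. -/
def pilotPowerD (i k : Fin K) : ℝ := ∑ j ∈ s.sharing i, s.pp j * s.vD j k + s.N0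

def muD (i k : Fin K) : ℝ := s.pp i * s.vD i k / s.pilotPowerD i k

def epsD (i k : Fin K) : ℝ := 1 - s.muD i k

def muC (n : Fin N) (k : Fin K) : ℝ := s.qp n * s.vC n k / (s.qp n * s.vC n k + s.N0)

def epsC (n : Fin N) (k : Fin K) : ℝ := 1 - s.muC n k

/-- The pilot signal matrix received at D2D receiver `k`, for channel vectors `gD i`, `gC n` from
the D2D transmitters and the CUs to that receiver and noise matrix `W`. -/
def receivedPilot (k : Fin K) (gD : Fin K → EuclideanSpace ℂ (Fin M))
    (gC : Fin N → EuclideanSpace ℂ (Fin M)) (W : Matrix (Fin M) (Fin τ) ℂ) :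
    Matrix (Fin M) (Fin τ) ℂ :=
  ∑ n, ((√(s.qp n * s.vC n k) : ℝ) : ℂ) •
      Matrix.vecMulVec (gC n).ofLp (star (s.pilotVec (s.cuPilot n)))
    + ∑ i, ((√(s.pp i * s.vD i k) : ℝ) : ℂ) •
      Matrix.vecMulVec (gD i).ofLp (star (s.pilotVec (s.pilot i)))
    + W

/-- MMSE estimate at D2D receiver `k` of the channel from D2D transmitter `i`, from the received
pilot matrix `Y`. -/
def estD (k : Fin K) (Y : Matrix (Fin M) (Fin τ) ℂ) (i : Fin K) : EuclideanSpace ℂ (Fin M) :=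
  ((√(s.pp i * s.vD i k) / s.pilotPowerD i k : ℝ) : ℂ) •
    WithLp.toLp 2 (Y *ᵥ s.pilotVec (s.pilot i))

/-- MMSE estimate at D2D receiver `k` of the channel from CU `n`. -/
def estC (k : Fin K) (Y : Matrix (Fin M) (Fin τ) ℂ) (n : Fin N) : EuclideanSpace ℂ (Fin M) :=
  ((√(s.qp n * s.vC n k) / (s.qp n * s.vC n k + s.N0) : ℝ) : ℂ) •
    WithLp.toLp 2 (Y *ᵥ s.pilotVec (s.cuPilot n))

/-- Effect of channel estimation error and noise at D2D receiver `k`. -/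
def alpha (k : Fin K) : ℝ :=
  ∑ i, s.ps i * s.vD i k * s.epsD i k + ∑ n, s.qs n * s.vC n k * s.epsC n k + s.N0

end System

namespace Cancellation

variable {s} {mc md : ℕ} (c : Cancellation s mc md)

/-- The CUs that receiver `k` does not cancel. -/
def uncancelledC (k : Fin K) : Finset (Fin N) := (c.cus k)ᶜ

/-- The D2D transmitters that receiver `k` does not cancel (including `k` itself). -/
def uncancelledD (k : Fin K) : Finset (Fin K) :=
  Finset.univ.filter fun i => s.pilot i ∉ c.pilots k

/-- The span of the estimated channel vectors of the cancelled interferers of receiver `k`. -/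
def cancelledSpan (k : Fin K) (Y : Matrix (Fin M) (Fin τ) ℂ) :
    Submodule ℂ (EuclideanSpace ℂ (Fin M)) :=
  Submodule.span ℂ ({x | ∃ n, n ∉ c.uncancelledC k ∧ x = s.estC k Y n} ∪
    {x | ∃ i, i ∉ c.uncancelledD k ∧ x = s.estD k Y i})

/-- The partial zero forcing filter of receiver `k`: the estimate of the channel of pair `k` is
projected onto the orthogonal complement of the estimated channels of the cancelled interferers,
and the projection is normalized. -/
def filter (k : Fin K) (Y : Matrix (Fin M) (Fin τ) ℂ) : EuclideanSpace ℂ (Fin M) :=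
  let x := (c.cancelledSpan k Y)ᗮ.starProjection (s.estD k Y k)
  ((‖x‖⁻¹ : ℝ) : ℂ) • x

def signal (k : Fin K) (Y : Matrix (Fin M) (Fin τ) ℂ) : ℝ :=
  s.ps k * s.vD k k * ‖inner ℂ (c.filter k Y) (s.estD k Y k)‖ ^ 2

def interferenceD (k : Fin K) (Y : Matrix (Fin M) (Fin τ) ℂ) : ℝ :=
  ∑ i ∈ c.uncancelledD k \ {k},
    s.ps i * s.vD i k * ‖inner ℂ (c.filter k Y) (s.estD k Y i)‖ ^ 2

def interferenceC (k : Fin K) (Y : Matrix (Fin M) (Fin τ) ℂ) : ℝ :=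
  ∑ n ∈ c.uncancelledC k,
    s.qs n * s.vC n k * ‖inner ℂ (c.filter k Y) (s.estC k Y n)‖ ^ 2

/-- The effective SINR of D2D link `k`. -/
def sinr (k : Fin K) (Y : Matrix (Fin M) (Fin τ) ℂ) : ℝ :=
  c.signal k Y /
    (c.interferenceD k Y + c.interferenceC k Y + s.alpha k * ‖c.filter k Y‖ ^ 2)

/-- The instantaneous rate of D2D link `k` when the coherence interval has length `T`. -/
def rate (T : ℝ) (k : Fin K) (Y : Matrix (Fin M) (Fin τ) ℂ) : ℝ :=
  (1 - τ / T) * Real.logb 2 (1 + c.sinr k Y)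

/-- The number `M - mc - md - 1`. -/
def dof (_c : Cancellation s mc md) : ℝ := (M : ℝ) - mc - md - 1

def phi (k : Fin K) : ℝ := c.dof * s.vD k k * s.muD k k

def psi (i k : Fin K) : ℝ :=
  if i = k ∨ i ∉ c.uncancelledD k then s.vD i k * s.epsD i k
  else if i ∈ s.sharing k then c.dof * s.vD i k * s.muD i k + s.vD i k * s.epsD i k
  else s.vD i k

def sigma (k : Fin K) : ℝ :=
  ∑ n ∈ c.uncancelledC k, s.qs n * s.vC n k
    + ∑ n ∈ (c.uncancelledC k)ᶜ, s.qs n * s.vC n k * s.epsC n k + s.N0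

def sinrLB (k : Fin K) : ℝ :=
  s.ps k * c.phi k / (∑ i, s.ps i * c.psi i k + c.sigma k)

end Cancellation

/-- The stochastic model at D2D receiver `k`: the channel vectors `gD i` and `gC n` have law
`CN(0, I)`, the columns of the noise matrix `W` have law `CN(0, N₀ I)`, and all these vectors are
independent (so the entries of `W` are i.i.d.). -/
structure IsChannelModel {Ω : Type*} [MeasurableSpace Ω] (P : Measure Ω) (s : System N K M τ)
    (gD : Fin K → Ω → EuclideanSpace ℂ (Fin M)) (gC : Fin N → Ω → EuclideanSpace ℂ (Fin M))
    (W : Ω → Matrix (Fin M) (Fin τ) ℂ) : Prop where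
  law_gD : ∀ i, HasLaw (gD i) (complexNormalVec M 1) P
  law_gC : ∀ n, HasLaw (gC n) (complexNormalVec M 1) P
  law_W : ∀ t, HasLaw (fun ω => WithLp.toLp 2 fun m => W ω m t)
    (complexNormalVec M s.N0.toNNReal) P
  indep : iIndepFun (Sum.elim gD (Sum.elim gC fun t ω => WithLp.toLp 2 fun m => W ω m t)) P

end D2D

end

/-! The pilot matrix is square and unitary, so `Y` carries the same information as its correlations
`z t` with the pilots. Under the channel model the vectors `z t` are independent and `z t` is
complex normal with covariance `s.obsVar k t • 1` (`IsChannelModel.hasLaw_pilotObs`). Every channel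
estimate is a nonnegative multiple of one `z t`, so the SINR is a function of `z`.

Let `r` be the projection of the receiver's own observation onto the orthogonal complement of the
cancelled estimates. Normalization removes the scale of the estimate, so the filter is `r / ‖r‖`,
and 1/SINR is a constant times a weighted sum of the quotients `|⟨r, z t⟩|² / ‖r‖⁴` over the
uncancelled interferers plus `alpha / ‖r‖²`. The function `x ↦ log (1 + 1 / x)` is convex and
decreasing, so by Jensen it is enough to bound the mean of this sum from above.

Three facts bound it. Write `P` for the variance of the own observation. (1) The cancelled span has
dimension at most `mc + md` and is independent of the own observation. Hence `‖r‖²` dominates a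
Gamma variable of shape `M - mc - md` and scale `P`, and the mean of `1 / ‖r‖²` is at most `1 / (P *
dof)`. (2) For an uncancelled interferer with another pilot, `z t` is independent of `r`; averaging
over `z t` turns `|⟨r, z t⟩|²` into `obsVar * ‖r‖²` and leads back to (1). (3) For an interferer
with the same pilot, `⟨r, z t⟩ = ‖r‖²`, so the quotient is 1. This pilot contamination is the term
of `psi` that grows with `dof`. Adding these bounds gives exactly the reciprocal of `sinrLB`. If
`dof` or the signal coefficient is zero, then `sinrLB = 0` and the bound is trivial. -/

noncomputable section

namespace D2D

open Complex

/-! ### Characteristic functions and linear images of complex normal vectors. -/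

section ComplexNormal

variable {E : Type*} [NormedAddCommGroup E] [InnerProductSpace ℂ E] [MeasurableSpace E]

/-- The measure `μ` has the characteristic function of a circularly symmetric complex normal law
with mean zero and covariance `v • 1`. -/
def IsComplexNormal (μ : Measure E) (v : ℝ≥0) : Prop :=
  ∀ u : E, ∫ x, cexp ((inner ℂ u x).re * I) ∂μ = cexp (-(v * ‖u‖ ^ 2 / 4))

theorem measurable_complexMk : Measurable fun p : ℝ × ℝ => Complex.mk p.1 p.2 :=
  Complex.measurableEquivRealProd.symm.measurable

instance (v : ℝ≥0) : IsProbabilityMeasure (complexNormal v) :=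
  Measure.isProbabilityMeasure_map measurable_complexMk.aemeasurable

instance (M : ℕ) (v : ℝ≥0) : IsProbabilityMeasure (complexNormalVec M v) :=
  Measure.isProbabilityMeasure_map (by fun_prop)

theorem isComplexNormal_complexNormal (v : ℝ≥0) : IsComplexNormal (complexNormal v) v := by
  intro u
  rw [complexNormal, integral_map measurable_complexMk.aemeasurable (by fun_prop)]
  have h : ∀ p : ℝ × ℝ, cexp ((inner ℂ u (Complex.mk p.1 p.2)).re * I)
      = cexp (u.re * p.1 * I) * cexp (u.im * p.2 * I) := by
    intro p
    rw [← Complex.exp_add]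
    congr 1
    simp
    ring
  simp_rw [h]
  rw [integral_prod_mul (fun x : ℝ => cexp (u.re * x * I)) (fun x : ℝ => cexp (u.im * x * I))]
  have key : ∀ t : ℝ, ∫ x : ℝ, cexp (t * x * I) ∂gaussianReal 0 (v / 2)
      = cexp (-(v * t ^ 2 / 4)) := by
    intro t
    have := charFun_gaussianReal (μ := 0) (v := v / 2) t
    rw [charFun_apply_real] at this
    rw [this]
    congr 1
    push_cast
    ring
  rw [key, key, ← Complex.exp_add]
  congr 1
  have : (‖u‖ : ℂ) ^ 2 = u.re ^ 2 + u.im ^ 2 := by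
    rw [← Complex.ofReal_pow, ← Complex.normSq_eq_norm_sq, Complex.normSq_apply]
    push_cast
    ring
  rw [this]
  ring

theorem isComplexNormal_complexNormalVec (M : ℕ) (v : ℝ≥0) :
    IsComplexNormal (complexNormalVec M v) v := by
  intro u
  rw [complexNormalVec, integral_map (by fun_prop) (by fun_prop)]
  have h : ∀ x : Fin M → ℂ, cexp ((inner ℂ u (WithLp.toLp 2 x)).re * I)
      = ∏ m, cexp ((inner ℂ (u m) (x m)).re * I) := by
    intro x
    rw [← Complex.exp_sum, PiLp.inner_apply, Complex.re_sum, Complex.ofReal_sum, Finset.sum_mul]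
  simp_rw [h]
  rw [integral_fintype_prod_eq_prod (fun m (x : ℂ) => cexp ((inner ℂ (u m) x).re * I))]
  simp_rw [isComplexNormal_complexNormal v _]
  rw [← Complex.exp_sum]
  congr 1
  have : (‖u‖ : ℂ) ^ 2 = ∑ m, (‖u m‖ : ℂ) ^ 2 := by
    have := EuclideanSpace.norm_sq_eq u
    exact_mod_cast this
  rw [this, Finset.mul_sum, Finset.sum_div, Finset.sum_neg_distrib]

/-- A linear image of independent complex normal vectors whose covariance is diagonal has
independent complex normal components. -/
theorem map_mulVec_pi_of_isComplexNormal [FiniteDimensional ℂ E] [BorelSpace E]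
    {ι κ : Type*} [Fintype ι] [Fintype κ]
    {μ : ι → Measure E} [∀ i, IsProbabilityMeasure (μ i)] {v : ι → ℝ≥0}
    (hμ : ∀ i, IsComplexNormal (μ i) (v i))
    {ν : κ → Measure E} [∀ t, IsProbabilityMeasure (ν t)] {c : κ → ℝ≥0}
    (hν : ∀ t, IsComplexNormal (ν t) (c t)) (A : κ → ι → ℂ)
    (hdiag : ∀ t, ∑ i, (v i : ℂ) * (A t i * star (A t i)) = c t)
    (hoff : ∀ t s, t ≠ s → ∑ i, (v i : ℂ) * (A t i * star (A s i)) = 0) :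
    (Measure.pi μ).map (fun g t => ∑ i, A t i • g i) = Measure.pi ν := by
  classical
  let _ : InnerProductSpace ℝ E := InnerProductSpace.complexToReal
  have : FiniteDimensional ℝ E := FiniteDimensional.complexToReal E
  have : ProperSpace E := FiniteDimensional.proper ℂ E
  have hmeas : Measurable fun (g : ι → E) (t : κ) => ∑ i, A t i • g i := by fun_prop
  have : IsProbabilityMeasure ((Measure.pi μ).map fun g t => ∑ i, A t i • g i) :=
    Measure.isProbabilityMeasure_map hmeas.aemeasurable
  refine Measure.ext_of_charFunDual (funext fun L => ?_)
  -- Riesz representers of the components of `L`, for the real inner product, which is the real part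
  -- of the complex one.
  set u : κ → E := fun t =>
    (InnerProductSpace.toDual ℝ E).symm (L.comp (ContinuousLinearMap.single ℝ (fun _ => E) t))
    with hu
  have hL : ∀ z : κ → E, L z = ∑ t, (inner ℂ (u t) (z t)).re := by
    intro z
    rw [← L.sum_comp_single]
    refine Finset.sum_congr rfl fun t _ => ?_
    have h1 : inner ℝ (u t) (z t) = (L.comp (ContinuousLinearMap.single ℝ (fun _ => E) t)) (z t) :=
      InnerProductSpace.toDual_symm_apply
    rw [← h1, real_inner_eq_re_inner ℂ]
    rfl
  have hLA : ∀ g : ι → E, L (fun t => ∑ i, A t i • g i)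
      = ∑ i, (inner ℂ (∑ t, star (A t i) • u t) (g i)).re := by
    intro g
    rw [hL]
    simp_rw [inner_sum, sum_inner, Complex.re_sum, inner_smul_right, inner_smul_left]
    rw [Finset.sum_comm]
    simp
  -- The hypotheses say `A diag(v) A* = diag(c)`. This makes the Gaussian exponents on the two sides
  -- equal.
  have hnorm : ∑ i, (v i : ℂ) * (‖∑ t, star (A t i) • u t‖ : ℂ) ^ 2
      = ∑ t, (c t : ℂ) * (‖u t‖ : ℂ) ^ 2 := by
    have hi : ∀ i, (v i : ℂ) * (‖∑ t, star (A t i) • u t‖ : ℂ) ^ 2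
        = ∑ t, ∑ s, (v i : ℂ) * (A t i * star (A s i)) * inner ℂ (u t) (u s) := by
      intro i
      have := inner_self_eq_norm_sq_to_K (𝕜 := ℂ) (∑ t, star (A t i) • u t)
      change _ = (‖∑ t, star (A t i) • u t‖ : ℂ) ^ 2 at this
      rw [← this]
      simp_rw [inner_sum, sum_inner, inner_smul_right, inner_smul_left, Finset.mul_sum]
      rw [Finset.sum_comm]
      refine Finset.sum_congr rfl fun t _ => Finset.sum_congr rfl fun s _ => ?_
      simp
      ring
    simp_rw [hi]
    rw [Finset.sum_comm]
    refine Finset.sum_congr rfl fun t _ => ?_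
    rw [Finset.sum_comm]
    simp_rw [← Finset.sum_mul]
    rw [Finset.sum_eq_single t]
    · rw [hdiag, inner_self_eq_norm_sq_to_K]
      rfl
    · intro s _ hs
      rw [hoff t s hs.symm, zero_mul]
    · simp
  rw [charFunDual_apply, charFunDual_apply, integral_map hmeas.aemeasurable (by fun_prop)]
  simp_rw [hLA, hL]
  have h1 : ∀ g : ι → E, cexp (((∑ i, (inner ℂ (∑ t, star (A t i) • u t) (g i)).re : ℝ) : ℂ) * I)
      = ∏ i, cexp ((inner ℂ (∑ t, star (A t i) • u t) (g i)).re * I) := by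
    intro g
    rw [← Complex.exp_sum, Complex.ofReal_sum, Finset.sum_mul]
  have h2 : ∀ z : κ → E, cexp (((∑ t, (inner ℂ (u t) (z t)).re : ℝ) : ℂ) * I)
      = ∏ t, cexp ((inner ℂ (u t) (z t)).re * I) := by
    intro g
    rw [← Complex.exp_sum, Complex.ofReal_sum, Finset.sum_mul]
  simp_rw [h1, h2]
  rw [integral_fintype_prod_eq_prod
      (fun i (x : E) => cexp ((inner ℂ (∑ t, star (A t i) • u t) x).re * I)),
    integral_fintype_prod_eq_prod (fun t (x : E) => cexp ((inner ℂ (u t) x).re * I))]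
  rw [Finset.prod_congr rfl fun i _ => hμ i _, Finset.prod_congr rfl fun t _ => hν t _]
  rw [← Complex.exp_sum, ← Complex.exp_sum, Finset.sum_neg_distrib, Finset.sum_neg_distrib,
    ← Finset.sum_div, ← Finset.sum_div, hnorm]

end ComplexNormal

end D2D

end

noncomputable section

namespace D2D

open Complex
open scoped ENNReal

/-! ### Second moments and inverse moments of complex normal coordinates. -/

section Moments

theorem lintegral_complexNormal (v : ℝ≥0) {f : ℂ → ℝ≥0∞} (hf : Measurable f) :
    ∫⁻ y, f y ∂complexNormal v
      = ∫⁻ a, ∫⁻ b, f (Complex.mk a b) ∂gaussianReal 0 (v / 2) ∂gaussianReal 0 (v / 2) := by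
  rw [complexNormal, lintegral_map hf measurable_complexMk,
    lintegral_prod (fun p : ℝ × ℝ => f (Complex.mk p.1 p.2)) (hf.comp measurable_complexMk).aemeasurable]

theorem lintegral_sq_gaussianReal (v : ℝ≥0) :
    ∫⁻ a, ENNReal.ofReal (a ^ 2) ∂gaussianReal 0 v = v := by
  have h1 : Integrable (fun a : ℝ => a ^ 2) (gaussianReal 0 v) :=
    (memLp_id_gaussianReal 2).integrable_sq
  rw [← ofReal_integral_eq_lintegral_ofReal h1 (ae_of_all _ fun a => sq_nonneg a)]
  have h2 := variance_fun_id_gaussianReal (μ := 0) (v := v)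
  rw [variance_of_integral_eq_zero (by fun_prop) (by simp)] at h2
  rw [h2, ENNReal.ofReal_coe_nnreal]

theorem lintegral_norm_sq_complexNormal (v : ℝ≥0) :
    ∫⁻ y, ENNReal.ofReal (‖y‖ ^ 2) ∂complexNormal v = v := by
  rw [lintegral_complexNormal v (by fun_prop)]
  have h : ∀ a b : ℝ, ENNReal.ofReal (‖Complex.mk a b‖ ^ 2)
      = ENNReal.ofReal (a ^ 2) + ENNReal.ofReal (b ^ 2) := by
    intro a b
    rw [← Complex.normSq_eq_norm_sq, Complex.normSq_apply,
      ← ENNReal.ofReal_add (sq_nonneg a) (sq_nonneg b)]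
    simp only [pow_two]
  simp_rw [h]
  have h2 : ∀ a : ℝ, ∫⁻ b, (ENNReal.ofReal (a ^ 2) + ENNReal.ofReal (b ^ 2)) ∂gaussianReal 0 (v / 2)
      = ENNReal.ofReal (a ^ 2) + (v / 2 : ℝ≥0) := by
    intro a
    rw [lintegral_add_left (by fun_prop), lintegral_sq_gaussianReal]
    simp
  simp_rw [h2]
  rw [lintegral_add_left (by fun_prop), lintegral_sq_gaussianReal]
  simp only [lintegral_const, measure_univ, mul_one]
  rw [← ENNReal.coe_add, add_halves]

theorem lintegral_exp_neg_sq_gaussianReal {v : ℝ≥0} (hv : v ≠ 0) {s : ℝ} (hs : 0 ≤ s) :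
    ∫⁻ a, ENNReal.ofReal (Real.exp (-s * a ^ 2)) ∂gaussianReal 0 v
      = ENNReal.ofReal (√(1 + 2 * v * s))⁻¹ := by
  have hv0 : (0 : ℝ) < v := by positivity
  have hint : Integrable (fun a : ℝ => Real.exp (-s * a ^ 2)) (gaussianReal 0 v) := by
    refine Integrable.of_bound (C := 1) (by fun_prop) (ae_of_all _ fun a => ?_)
    rw [Real.norm_eq_abs, Real.abs_exp]
    exact Real.exp_le_one_iff.2 (by nlinarith [mul_nonneg hs (sq_nonneg a)])
  rw [← ofReal_integral_eq_lintegral_ofReal hint (ae_of_all _ fun a => (Real.exp_pos _).le),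
    integral_gaussianReal_eq_integral_smul hv]
  congr 1
  have h : ∀ a : ℝ, gaussianPDFReal 0 v a • Real.exp (-s * a ^ 2)
      = (√(2 * Real.pi * v))⁻¹ * Real.exp (-(s + 1 / (2 * v)) * a ^ 2) := by
    intro a
    rw [gaussianPDFReal, smul_eq_mul, mul_assoc, ← Real.exp_add]
    congr 2
    field_simp
    ring
  simp_rw [h]
  rw [integral_const_mul, integral_gaussian, ← Real.sqrt_inv, ← Real.sqrt_inv, ← Real.sqrt_mul]
  · congr 1
    have : (0 : ℝ) < 1 + 2 * v * s := by positivity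
    have h3 : (s + 1 / (2 * v) : ℝ) = (1 + 2 * v * s) / (2 * v) := by field_simp; ring
    rw [h3]
    have := Real.pi_pos
    field_simp
  · positivity

theorem lintegral_exp_neg_norm_sq_complexNormal {v : ℝ≥0} (hv : v ≠ 0) {s : ℝ} (hs : 0 ≤ s) :
    ∫⁻ y, ENNReal.ofReal (Real.exp (-s * ‖y‖ ^ 2)) ∂complexNormal v
      = ENNReal.ofReal (1 + v * s)⁻¹ := by
  rw [lintegral_complexNormal v (by fun_prop)]
  have h : ∀ a b : ℝ, ENNReal.ofReal (Real.exp (-s * ‖Complex.mk a b‖ ^ 2))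
      = ENNReal.ofReal (Real.exp (-s * a ^ 2)) * ENNReal.ofReal (Real.exp (-s * b ^ 2)) := by
    intro a b
    rw [← Complex.normSq_eq_norm_sq, Complex.normSq_apply,
      ← ENNReal.ofReal_mul (Real.exp_pos _).le, ← Real.exp_add]
    congr 2
    ring
  have hv2 : v / 2 ≠ 0 := by simpa using hv
  simp_rw [h]
  simp_rw [lintegral_const_mul _ (show Measurable fun b : ℝ =>
    ENNReal.ofReal (Real.exp (-s * b ^ 2)) by fun_prop)]
  rw [lintegral_mul_const _ (by fun_prop), lintegral_exp_neg_sq_gaussianReal hv2 hs,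
    ← ENNReal.ofReal_mul (by positivity), ← mul_inv, Real.mul_self_sqrt (by positivity)]
  congr 2
  push_cast
  ring

/-- The Laplace representation of `1 / r`. It holds at `r = 0` too, where both sides are infinite,
so no null set has to be removed before exchanging integrals. -/
theorem inv_ofReal_le_lintegral_exp {r : ℝ} (hr : 0 ≤ r) :
    (ENNReal.ofReal r)⁻¹ ≤ ∫⁻ s in Set.Ioi (0 : ℝ), ENNReal.ofReal (Real.exp (-s * r)) := by
  rcases hr.eq_or_lt with rfl | hr
  · simp
  have h1 : ∀ s : ℝ, -s * r = -r * s := fun s => by ring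
  simp_rw [h1]
  have hint : IntegrableOn (fun s => Real.exp (-r * s)) (Set.Ioi 0) := integrableOn_exp_mul_Ioi (by linarith) 0
  rw [← ofReal_integral_eq_lintegral_ofReal hint (ae_of_all _ fun a => (Real.exp_pos _).le),
    integral_exp_mul_Ioi (by linarith), ← ENNReal.ofReal_inv_of_pos hr]
  apply ENNReal.ofReal_le_ofReal
  simp

theorem lintegral_inv_one_add_pow {c : ℝ} (hc : 0 < c) (n : ℕ) :
    ∫⁻ s in Set.Ioi (0 : ℝ), ENNReal.ofReal (((1 + c * s) ^ (n + 2))⁻¹)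
      = ENNReal.ofReal (1 / (c * (n + 1))) := by
  -- The antiderivative that vanishes at infinity; the integral is `-g 0`.
  set g : ℝ → ℝ := fun s => -(1 / (c * (n + 1))) * ((1 + c * s) ^ (n + 1))⁻¹ with hg
  have hpos : ∀ s ∈ Set.Ici (0 : ℝ), 0 < 1 + c * s := fun s hs => by
    have : (0 : ℝ) ≤ s := hs
    positivity
  have hder : ∀ s ∈ Set.Ici (0 : ℝ), HasDerivAt g (((1 + c * s) ^ (n + 2))⁻¹) s := by
    intro s hs
    have h0 := hpos s hs
    have h1 : HasDerivAt (fun s : ℝ => 1 + c * s) c s := by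
      simpa using ((hasDerivAt_id s).const_mul c).const_add 1
    have h2 := ((h1.fun_pow (n + 1)).fun_inv (pow_pos h0 _).ne').const_mul (-(1 / (c * (n + 1))))
    refine h2.congr_deriv ?_
    push_cast
    field_simp
    ring
  have hlim : Filter.Tendsto g Filter.atTop (nhds 0) := by
    have h1 : Filter.Tendsto (fun s : ℝ => 1 + c * s) Filter.atTop Filter.atTop :=
      Filter.tendsto_atTop_add_const_left _ _ (Filter.tendsto_id.const_mul_atTop hc)
    have h2 := (((Filter.tendsto_pow_atTop (Nat.succ_ne_zero n)).comp h1).inv_tendsto_atTop).const_mul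
      (-(1 / (c * (n + 1))))
    rw [mul_zero] at h2
    exact h2
  have hnn : ∀ s ∈ Set.Ioi (0 : ℝ), 0 ≤ ((1 + c * s) ^ (n + 2))⁻¹ := fun s hs =>
    inv_nonneg.2 (pow_pos (hpos s (le_of_lt hs : (0 : ℝ) ≤ s)) _).le
  have hint := integrableOn_Ioi_deriv_of_nonneg' hder hnn hlim
  rw [← ofReal_integral_eq_lintegral_ofReal hint (ae_restrict_of_forall_mem measurableSet_Ioi hnn),
    integral_Ioi_of_hasDerivAt_of_nonneg' hder hnn hlim]
  congr 1
  simp [hg]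

/-- The sum is Gamma distributed with shape `n + 2`. Rather than using its density, insert the
Laplace representation of the reciprocal and apply Tonelli; independence yields the factor `(1 + c *
s)⁻¹` once per coordinate. Two coordinates at least are needed for the resulting integral to
converge. -/
theorem lintegral_inv_sum_norm_sq_le {c : ℝ≥0} (hc : c ≠ 0) (n : ℕ) :
    ∫⁻ y, (ENNReal.ofReal (∑ j, ‖y j‖ ^ 2))⁻¹ ∂Measure.pi (fun _ : Fin (n + 2) => complexNormal c)
      ≤ ENNReal.ofReal (1 / (c * (n + 1))) := by
  have hc0 : (0 : ℝ) < c := by positivity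
  calc _ ≤ ∫⁻ y, (∫⁻ s in Set.Ioi (0 : ℝ), ENNReal.ofReal (Real.exp (-s * ∑ j, ‖y j‖ ^ 2)))
        ∂Measure.pi (fun _ : Fin (n + 2) => complexNormal c) :=
        lintegral_mono fun y => inv_ofReal_le_lintegral_exp (by positivity)
    _ = ∫⁻ s in Set.Ioi (0 : ℝ), ∫⁻ y, ENNReal.ofReal (Real.exp (-s * ∑ j, ‖y j‖ ^ 2))
        ∂Measure.pi (fun _ : Fin (n + 2) => complexNormal c) := by
        rw [lintegral_lintegral_swap]
        exact Measurable.aemeasurable (by fun_prop)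
    _ = ∫⁻ s in Set.Ioi (0 : ℝ), ENNReal.ofReal (((1 + c * s) ^ (n + 2))⁻¹) := by
        refine setLIntegral_congr_fun measurableSet_Ioi fun s hs => ?_
        have hs0 : (0 : ℝ) ≤ s := le_of_lt hs
        have h1 : ∀ y : Fin (n + 2) → ℂ, ENNReal.ofReal (Real.exp (-s * ∑ j, ‖y j‖ ^ 2))
            = ∏ j, ENNReal.ofReal (Real.exp (-s * ‖y j‖ ^ 2)) := by
          intro y
          rw [← ENNReal.ofReal_prod_of_nonneg fun _ _ => (Real.exp_pos _).le, ← Real.exp_sum,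
            Finset.mul_sum]
        have hind : iIndepFun (fun (j : Fin (n + 2)) (y : Fin (n + 2) → ℂ) =>
            ENNReal.ofReal (Real.exp (-s * ‖y j‖ ^ 2)))
            (Measure.pi fun _ : Fin (n + 2) => complexNormal c) :=
          iIndepFun_pi (X := fun (_ : Fin (n + 2)) (y : ℂ) =>
            ENNReal.ofReal (Real.exp (-s * ‖y‖ ^ 2))) (fun j => by fun_prop)
        simp_rw [h1]
        rw [lintegral_prod_eq_prod_lintegral_of_indepFun _ _ hind (fun j => by fun_prop)]
        have h2 : ∀ j : Fin (n + 2), ∫⁻ y, ENNReal.ofReal (Real.exp (-s * ‖y j‖ ^ 2))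
            ∂(Measure.pi fun _ : Fin (n + 2) => complexNormal c)
            = ENNReal.ofReal (1 + c * s)⁻¹ := by
          intro j
          rw [← lintegral_exp_neg_norm_sq_complexNormal hc hs0]
          exact (measurePreserving_eval (fun _ : Fin (n + 2) => complexNormal c) j).lintegral_comp
            (f := fun y : ℂ => ENNReal.ofReal (Real.exp (-s * ‖y‖ ^ 2))) (by fun_prop)
        simp_rw [h2]
        rw [Finset.prod_const, Finset.card_univ, Fintype.card_fin, ← ENNReal.ofReal_pow (by positivity),
          inv_pow]
    _ = _ := lintegral_inv_one_add_pow hc0 n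

end Moments

/-! ### Projections of a complex normal vector. -/

section Projection

variable {M : ℕ}

/-- Components along orthogonal vectors are uncorrelated, hence independent. The vectors need not be
normalized, so one arbitrary vector is covered as well as an orthonormal family. -/
theorem map_inner_complexNormalVec {κ : Type*} [Fintype κ] (v : ℝ≥0)
    (e : κ → EuclideanSpace ℂ (Fin M)) (c : κ → ℝ≥0) (hc : ∀ j, v * ‖e j‖ ^ 2 = (c j : ℝ))
    (he : ∀ i j, i ≠ j → inner ℂ (e i) (e j) = 0) :
    (complexNormalVec M v).map (fun x j => inner ℂ (e j) x)
      = Measure.pi fun j => complexNormal (c j) := by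
  rw [complexNormalVec, Measure.map_map (by fun_prop) (by fun_prop)]
  rw [← map_mulVec_pi_of_isComplexNormal (fun _ : Fin M => isComplexNormal_complexNormal v)
    (fun j => isComplexNormal_complexNormal (c j)) (fun j m => star (e j m))]
  · congr 1
    ext x j
    simp [PiLp.inner_apply, mul_comm]
  · intro j
    rw [← Finset.mul_sum]
    have h := inner_self_eq_norm_sq_to_K (𝕜 := ℂ) (e j)
    rw [PiLp.inner_apply] at h
    have h2 : ((v * ‖e j‖ ^ 2 : ℝ) : ℂ) = ((c j : ℝ) : ℂ) := by rw [hc j]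
    push_cast at h2
    rw [← h2]
    congr 1
    refine Eq.trans (Finset.sum_congr rfl fun m _ => ?_) h
    rw [star_star, RCLike.inner_apply, mul_comm]
    rfl
  · intro i j hij
    rw [← Finset.mul_sum]
    have h := he i j hij
    rw [PiLp.inner_apply] at h
    have : ∑ m, star (e i m) * star (star (e j m)) = 0 := by
      rw [← h]
      refine Finset.sum_congr rfl fun m _ => ?_
      rw [star_star, RCLike.inner_apply, mul_comm]
      rfl
    rw [this, mul_zero]

theorem lintegral_norm_inner_sq_complexNormalVec (v : ℝ≥0) (b : EuclideanSpace ℂ (Fin M)) :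
    ∫⁻ x, ENNReal.ofReal (‖inner ℂ b x‖ ^ 2) ∂complexNormalVec M v
      = ENNReal.ofReal (v * ‖b‖ ^ 2) := by
  have h := map_inner_complexNormalVec v (fun _ : Fin 1 => b)
    (fun _ => v * ⟨‖b‖ ^ 2, sq_nonneg _⟩) (fun j => rfl) (fun i j hij => absurd (Subsingleton.elim i j) hij)
  have h2 := (measurePreserving_eval (fun _ : Fin 1 => complexNormal (v * ⟨‖b‖ ^ 2, sq_nonneg _⟩))
    0).lintegral_comp (f := fun y : ℂ => ENNReal.ofReal (‖y‖ ^ 2)) (by fun_prop)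
  rw [← h, lintegral_map (by fun_prop) (by fun_prop), lintegral_norm_sq_complexNormal] at h2
  refine h2.trans ?_
  rw [ ← ENNReal.ofReal_coe_nnreal]
  rfl

theorem lintegral_norm_sq_complexNormalVec_lt_top (v : ℝ≥0) :
    ∫⁻ x, ENNReal.ofReal (‖x‖ ^ 2) ∂complexNormalVec M v < ∞ := by
  have h : ∀ x : EuclideanSpace ℂ (Fin M), ENNReal.ofReal (‖x‖ ^ 2)
      = ∑ m, ENNReal.ofReal (‖inner ℂ (EuclideanSpace.single m (1 : ℂ)) x‖ ^ 2) := by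
    intro x
    rw [EuclideanSpace.norm_sq_eq, ENNReal.ofReal_sum_of_nonneg fun _ _ => by positivity]
    simp [EuclideanSpace.inner_single_left]
  simp_rw [h]
  rw [lintegral_finsetSum _ fun m _ => by fun_prop]
  simp_rw [lintegral_norm_inner_sq_complexNormalVec]
  exact ENNReal.sum_lt_top.2 fun _ _ => ENNReal.ofReal_lt_top

/-- The complement of `V` has dimension at least `M - m`. Keeping only `M - m` orthonormal
directions in it shrinks the squared norm and enlarges its reciprocal, so a degenerate `V` does no
harm. -/
theorem lintegral_inv_norm_starProjection_sq_le {v : ℝ≥0} (hv : v ≠ 0) {m : ℕ} (hm : m + 2 ≤ M)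
    (V : Submodule ℂ (EuclideanSpace ℂ (Fin M))) (hV : Module.finrank ℂ V ≤ m) :
    ∫⁻ x, (ENNReal.ofReal (‖Vᗮ.starProjection x‖ ^ 2))⁻¹ ∂complexNormalVec M v
      ≤ ENNReal.ofReal (1 / (v * (M - m - 1))) := by
  obtain ⟨n, rfl⟩ := Nat.exists_eq_add_of_le hm
  have hfr : n + 2 ≤ Module.finrank ℂ Vᗮ := by
    have h1 := Submodule.finrank_add_finrank_orthogonal V
    rw [finrank_euclideanSpace_fin] at h1
    omega
  set b := stdOrthonormalBasis ℂ Vᗮ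
  -- Here `M = m + 2 + n`, so `n + 2 = M - m` directions are kept.
  set e : Fin (n + 2) → EuclideanSpace ℂ (Fin (m + 2 + n)) := fun j => (b (Fin.castLE hfr j) : _)
    with he
  have hon : Orthonormal ℂ e :=
    (b.orthonormal.comp_linearIsometry Vᗮ.subtypeₗᵢ).comp _ (Fin.castLE_injective hfr)
  have hmap := map_inner_complexNormalVec v e (fun _ => v) (fun j => by simp [hon.1 j])
    (fun i j hij => hon.2 hij)
  have hle : ∀ x, ∑ j, ‖inner ℂ (e j) x‖ ^ 2 ≤ ‖Vᗮ.starProjection x‖ ^ 2 := by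
    intro x
    have h1 : ∀ j, inner ℂ (e j) x = inner ℂ (e j) (Vᗮ.starProjection x) := by
      intro j
      rw [← Submodule.inner_starProjection_left_eq_right,
        Submodule.starProjection_eq_self_iff.2 (b (Fin.castLE hfr j)).2]
    simp_rw [h1]
    exact hon.sum_inner_products_le _
  calc _ ≤ ∫⁻ x, (ENNReal.ofReal (∑ j, ‖inner ℂ (e j) x‖ ^ 2))⁻¹
        ∂complexNormalVec (m + 2 + n) v :=
        lintegral_mono fun x => ENNReal.inv_le_inv.2 (ENNReal.ofReal_le_ofReal (hle x))
    _ = ∫⁻ y, (ENNReal.ofReal (∑ j, ‖y j‖ ^ 2))⁻¹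
        ∂Measure.pi (fun _ : Fin (n + 2) => complexNormal v) := by
        rw [← hmap, lintegral_map (by fun_prop) (by fun_prop)]
    _ ≤ _ := lintegral_inv_sum_norm_sq_le hv n
    _ = _ := by
        congr 3
        push_cast
        ring

end Projection

end D2D

end

/-! ### Measurability of projections, integration over one coordinate, and Jensen's inequality. -/

noncomputable section

namespace D2D

open scoped ENNReal

/-- One Gram–Schmidt step. It expresses the projection through inner products and norms, from which
measurability in the spanning vectors can be read off. -/
theorem starProjection_orthogonal_span_insert {E : Type*} [NormedAddCommGroup E]
    [InnerProductSpace ℂ E] [FiniteDimensional ℂ E] (v : E) (s : Set E) (y : E) :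
    (Submodule.span ℂ (insert v s))ᗮ.starProjection y
      = (Submodule.span ℂ s)ᗮ.starProjection y
        - (inner ℂ ((Submodule.span ℂ s)ᗮ.starProjection v) y
            / ((‖(Submodule.span ℂ s)ᗮ.starProjection v‖ ^ 2 : ℝ) : ℂ)) •
          (Submodule.span ℂ s)ᗮ.starProjection v := by
  set V := Submodule.span ℂ s
  set u := Vᗮ.starProjection v with hu
  have hum : u ∈ Vᗮ := Submodule.starProjection_apply_mem _ _
  have huv : v - u ∈ V := by
    rw [hu, Submodule.starProjection_orthogonal_val, sub_sub_cancel]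
    exact Submodule.starProjection_apply_mem _ _
  have hyV : y - Vᗮ.starProjection y ∈ V := by
    rw [Submodule.starProjection_orthogonal_val, sub_sub_cancel]
    exact Submodule.starProjection_apply_mem _ _
  have hsub : V ≤ Submodule.span ℂ (insert v s) := Submodule.span_mono (Set.subset_insert v s)
  have huW : u ∈ Submodule.span ℂ (insert v s) := by
    have : u = v - (v - u) := by abel
    rw [this]
    exact Submodule.sub_mem _ (Submodule.subset_span (Set.mem_insert v s)) (hsub huv)
  refine (Submodule.eq_starProjection_of_mem_orthogonal ?_ ?_)
  · have hmemV : ∀ a : ℂ, Vᗮ.starProjection y - a • u ∈ Vᗮ := fun a =>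
      Submodule.sub_mem _ (Submodule.starProjection_apply_mem _ _) (Submodule.smul_mem _ _ hum)
    set a : ℂ := inner ℂ u y / ((‖u‖ ^ 2 : ℝ) : ℂ) with ha
    set x := Vᗮ.starProjection y - a • u with hx
    have hux : inner ℂ u x = 0 := by
      have h1 : inner ℂ u (Vᗮ.starProjection y) = inner ℂ u y := by
        rw [← Submodule.inner_starProjection_left_eq_right,
          Submodule.starProjection_eq_self_iff.2 hum]
      rw [hx, inner_sub_right, inner_smul_right, h1, inner_self_eq_norm_sq_to_K, ha]
      -- If `v` already lies in the span, the division by zero gives the correct correction, zero.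
      by_cases hu0 : u = 0
      · simp [hu0]
      · have : ((‖u‖ : ℝ) : ℂ) ≠ 0 := by simpa using hu0
        push_cast
        simp only [Complex.coe_algebraMap]
        field_simp
        simp
    have hvx : inner ℂ v x = 0 := by
      have h2 : inner ℂ (v - u) x = 0 := (hmemV a) _ huv
      rw [inner_sub_left, hux, sub_zero] at h2
      exact h2
    rw [Submodule.mem_orthogonal]
    intro w hw
    induction hw using Submodule.span_induction with
    | mem w hw =>
      rcases hw with rfl | hw
      · exact hvx
      · exact (hmemV a) _ (Submodule.subset_span hw)
    | zero => simp
    | add w₁ w₂ _ _ h₁ h₂ => rw [inner_add_left, h₁, h₂, add_zero]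
    | smul b w _ h => rw [inner_smul_left, h, mul_zero]
  · rw [Submodule.orthogonal_orthogonal, ← sub_add]
    exact Submodule.add_mem _ (hsub hyV) (Submodule.smul_mem _ _ huW)

/-- Induction by Gram–Schmidt steps. The projected vector `g` is generalized because each step
projects both `g` and the new spanning vector. -/
theorem measurable_starProjection_orthogonal_span {α ι E : Type*} [MeasurableSpace α]
    [NormedAddCommGroup E] [InnerProductSpace ℂ E] [FiniteDimensional ℂ E] [MeasurableSpace E]
    [BorelSpace E] {f : ι → α → E} (hf : ∀ i, Measurable (f i)) (s : Finset ι)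
    {g : α → E} (hg : Measurable g) :
    Measurable fun a => (Submodule.span ℂ ((fun i => f i a) '' (s : Set ι)))ᗮ.starProjection (g a) := by
  classical
  have : ProperSpace E := FiniteDimensional.proper ℂ E
  induction s using Finset.induction_on generalizing g with
  | empty => simpa [Submodule.starProjection_top] using hg
  | insert i s _ ih =>
    simp_rw [Finset.coe_insert, Set.image_insert_eq, starProjection_orthogonal_span_insert]
    have h1 := ih (hf i)
    have h2 := ih hg
    refine h2.sub (Measurable.smul (Measurable.div ?_ ?_) h1)
    · exact h1.inner hg
    · exact Complex.measurable_ofReal.comp (h1.norm.pow_const 2)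

/-- Resampling a coordinate preserves a product law. In this form, conditioning on the other
coordinates becomes an inner integral with `z` fixed. -/
theorem lintegral_pi_eq_lintegral_update {ι : Type*} [Fintype ι] [DecidableEq ι] {X : ι → Type*}
    [∀ i, MeasurableSpace (X i)] (μ : ∀ i, Measure (X i)) [∀ i, IsProbabilityMeasure (μ i)]
    {f : (∀ i, X i) → ℝ≥0∞} (hf : Measurable f) (i : ι) :
    ∫⁻ z, f z ∂Measure.pi μ
      = ∫⁻ z, ∫⁻ x, f (Function.update z i x) ∂μ i ∂Measure.pi μ := by
  refine lintegral_eq_of_lmarginal_eq {i} hf ?_ ?_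
  · rw [← lmarginal_singleton]
    exact hf.lmarginal μ
  · rw [lmarginal_singleton, lmarginal_singleton]
    ext z
    simp

/-- A tangent line inequality for the convex function `x ↦ log (1 + 1 / x)`. -/
theorem log_one_add_inv_ge {x y : ℝ} (hx : 0 < x) (hy : 0 < y) :
    Real.log (1 + y⁻¹) + (y * (y + 1))⁻¹ * (y - x) ≤ Real.log (1 + x⁻¹) := by
  have h1 := Real.one_sub_inv_le_log_of_pos (x := (1 + x⁻¹) / (1 + y⁻¹)) (by positivity)
  rw [Real.log_div (by positivity) (by positivity)] at h1
  have h2 : (y * (y + 1))⁻¹ * (y - x) ≤ 1 - ((1 + x⁻¹) / (1 + y⁻¹))⁻¹ := by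
    -- The gap left by `1 - 1 / u ≤ log u` is an explicit square over a positive quantity.
    have : 1 - ((1 + x⁻¹) / (1 + y⁻¹))⁻¹ - (y * (y + 1))⁻¹ * (y - x)
        = (y - x) ^ 2 / ((1 + x) * y * (y + 1)) := by
      field_simp
      ring
    have h3 : 0 ≤ (y - x) ^ 2 / ((1 + x) * y * (y + 1)) := by positivity
    linarith
  linarith

/-- Jensen's inequality for the convex function `x ↦ log (1 + 1 / x)`. -/
theorem log_one_add_inv_le_integral {α : Type*} [MeasurableSpace α] {μ : Measure α}
    [IsProbabilityMeasure μ] {η : α → ℝ} {X : α → ℝ} {y : ℝ} (hy : 0 < y)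
    (hX : AEMeasurable X μ)
    (hpos : ∀ᵐ a ∂μ, 0 < X a) (hη : ∀ᵐ a ∂μ, η a = (X a)⁻¹)
    (hle : ∫⁻ a, ENNReal.ofReal (X a) ∂μ ≤ ENNReal.ofReal y)
    (hint : Integrable (fun a => Real.log (1 + η a)) μ) :
    Real.log (1 + y⁻¹) ≤ ∫ a, Real.log (1 + η a) ∂μ := by
  have h0 : 0 ≤ᵐ[μ] X := hpos.mono fun a ha => ha.le
  have hXint : Integrable X μ := by
    refine ⟨hX.aestronglyMeasurable, ?_⟩
    rw [hasFiniteIntegral_iff_ofReal h0]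
    exact hle.trans_lt ENNReal.ofReal_lt_top
  have hXle : ∫ a, X a ∂μ ≤ y := by
    rw [integral_eq_lintegral_of_nonneg_ae h0 hX.aestronglyMeasurable]
    exact ENNReal.toReal_le_of_le_ofReal hy.le hle
  have hc : 0 ≤ (y * (y + 1))⁻¹ := by positivity
  -- The tangent is taken at `y`, not at the mean of `X`; since the mean is at most `y`, the linear
  -- term has a nonnegative integral and can be added.
  calc Real.log (1 + y⁻¹) ≤ Real.log (1 + y⁻¹) + (y * (y + 1))⁻¹ * (y - ∫ a, X a ∂μ) := by
        have := mul_nonneg hc (sub_nonneg.2 hXle)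
        linarith
    _ = ∫ a, (Real.log (1 + y⁻¹) + (y * (y + 1))⁻¹ * (y - X a)) ∂μ := by
        rw [integral_add (by fun_prop) (by fun_prop), integral_const_mul,
          integral_sub (by fun_prop) hXint]
        simp
    _ ≤ _ := by
        refine integral_mono_ae (by fun_prop) hint ?_
        filter_upwards [hpos, hη] with a ha hηa
        rw [hηa]
        exact log_one_add_inv_ge ha hy

end D2D

end

/-! ### The pilot correlations and their joint law. -/

noncomputable section

namespace D2D

variable {N K M τ : ℕ}

namespace System

variable (s : System N K M τ)

/-- The received pilot matrix, correlated with the pilot of index `t`. -/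
def pilotObs (Y : Matrix (Fin M) (Fin τ) ℂ) (t : Fin τ) : EuclideanSpace ℂ (Fin M) :=
  WithLp.toLp 2 (Y *ᵥ s.pilotVec t)

/-- The received pilot matrix with given correlations with the pilots. -/
def ofObs (z : Fin τ → EuclideanSpace ℂ (Fin M)) : Matrix (Fin M) (Fin τ) ℂ :=
  (Matrix.of fun m t => z t m) * s.pilotMatrixᴴ

/-- The variance of the entries of `s.pilotObs Y t`. -/
def obsVar (k : Fin K) (t : Fin τ) : ℝ :=
  ∑ i with s.pilot i = t, s.pp i * s.vD i k + ∑ n with s.cuPilot n = t, s.qp n * s.vC n k + s.N0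

theorem pilotObs_ofObs (z : Fin τ → EuclideanSpace ℂ (Fin M)) (t : Fin τ) :
    s.pilotObs (s.ofObs z) t = z t := by
  have h : s.ofObs z * s.pilotMatrix = Matrix.of fun m t => z t m := by
    rw [ofObs, Matrix.mul_assoc, s.pilotMatrix_orthonormal, Matrix.mul_one]
  ext m
  exact congrFun (congrFun h m) t

/-- Uses that the pilot matrix is square: its left inverse is also a right inverse, so nothing is
lost in passing to the correlations. -/
theorem ofObs_pilotObs (Y : Matrix (Fin M) (Fin τ) ℂ) : s.ofObs (s.pilotObs Y) = Y := by
  have h : (Matrix.of fun m t => s.pilotObs Y t m) = Y * s.pilotMatrix := rfl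
  rw [ofObs, h, Matrix.mul_assoc, mul_eq_one_comm.1 s.pilotMatrix_orthonormal, Matrix.mul_one]

theorem estD_eq (k : Fin K) (Y : Matrix (Fin M) (Fin τ) ℂ) (i : Fin K) :
    s.estD k Y i = ((√(s.pp i * s.vD i k) / s.pilotPowerD i k : ℝ) : ℂ) •
      s.pilotObs Y (s.pilot i) := rfl

theorem estC_eq (k : Fin K) (Y : Matrix (Fin M) (Fin τ) ℂ) (n : Fin N) :
    s.estC k Y n = ((√(s.qp n * s.vC n k) / (s.qp n * s.vC n k + s.N0) : ℝ) : ℂ) •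
      s.pilotObs Y (s.cuPilot n) := rfl

theorem cuPilot_injective : Function.Injective s.cuPilot := Fin.castLE_injective s.N_lt.le

theorem cuPilot_ne_pilot (n : Fin N) (i : Fin K) : s.cuPilot n ≠ s.pilot i := by
  intro h
  have h1 := s.le_pilot i
  rw [← h] at h1
  exact absurd n.2 (not_lt.2 h1)

theorem obsVar_pilot (i k : Fin K) : s.obsVar k (s.pilot i) = s.pilotPowerD i k := by
  simp [obsVar, pilotPowerD, sharing, s.cuPilot_ne_pilot]

theorem obsVar_cuPilot (n : Fin N) (k : Fin K) :
    s.obsVar k (s.cuPilot n) = s.qp n * s.vC n k + s.N0 := by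
  simp [obsVar, s.cuPilot_injective.eq_iff, fun i => (s.cuPilot_ne_pilot n i).symm,
    Finset.filter_eq']

theorem obsVar_pos (k : Fin K) (t : Fin τ) : 0 < s.obsVar k t := by
  have h1 : 0 ≤ ∑ i with s.pilot i = t, s.pp i * s.vD i k :=
    Finset.sum_nonneg fun i _ => mul_nonneg (s.pp_nonneg i) (s.vD_nonneg i k)
  have h2 : 0 ≤ ∑ n with s.cuPilot n = t, s.qp n * s.vC n k :=
    Finset.sum_nonneg fun n _ => mul_nonneg (s.qp_nonneg n) (s.vC_nonneg n k)
  have h3 := s.N0_pos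
  rw [obsVar]
  linarith

theorem pilotPowerD_pos (i k : Fin K) : 0 < s.pilotPowerD i k := by
  rw [← s.obsVar_pilot]
  exact s.obsVar_pos k _

theorem star_pilotVec_dotProduct (t t' : Fin τ) :
    star (s.pilotVec t) ⬝ᵥ s.pilotVec t' = if t = t' then 1 else 0 := by
  have h := congrFun (congrFun s.pilotMatrix_orthonormal t) t'
  rwa [Matrix.one_apply] at h

/-- The coefficients of the channel vectors and the noise vectors in `s.pilotObs Y t`. -/
def obsCoeff (k : Fin K) (t : Fin τ) : Fin K ⊕ (Fin N ⊕ Fin τ) → ℂ :=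
  Sum.elim (fun i => if s.pilot i = t then ((√(s.pp i * s.vD i k) : ℝ) : ℂ) else 0)
    (Sum.elim (fun n => if s.cuPilot n = t then ((√(s.qp n * s.vC n k) : ℝ) : ℂ) else 0)
      (s.pilotVec t))

theorem pilotObs_receivedPilot (k : Fin K) (gD : Fin K → EuclideanSpace ℂ (Fin M))
    (gC : Fin N → EuclideanSpace ℂ (Fin M)) (W : Matrix (Fin M) (Fin τ) ℂ) (t : Fin τ) :
    s.pilotObs (s.receivedPilot k gD gC W) t = ∑ i, s.obsCoeff k t i •
      Sum.elim gD (Sum.elim gC fun t => WithLp.toLp 2 fun m => W m t) i := by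
  ext m
  simp only [pilotObs, receivedPilot, Matrix.add_mulVec, Matrix.sum_mulVec, Matrix.smul_mulVec,
    Matrix.vecMulVec_mulVec, star_pilotVec_dotProduct, Fintype.sum_sum_type, obsCoeff,
    Sum.elim_inl, Sum.elim_inr, PiLp.add_apply, Pi.add_apply, Finset.sum_apply,
    WithLp.ofLp_sum, WithLp.ofLp_smul, Pi.smul_apply]
  have h1 : ∑ n, ((√(s.qp n * s.vC n k) : ℝ) : ℂ) •
      (MulOpposite.op (if s.cuPilot n = t then (1 : ℂ) else 0) • (gC n) m)
      = ∑ n, (if s.cuPilot n = t then ((√(s.qp n * s.vC n k) : ℝ) : ℂ) else 0) • (gC n) m := by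
    refine Finset.sum_congr rfl fun n _ => ?_
    split_ifs <;> simp
  have h2 : ∑ i, ((√(s.pp i * s.vD i k) : ℝ) : ℂ) •
      (MulOpposite.op (if s.pilot i = t then (1 : ℂ) else 0) • (gD i) m)
      = ∑ i, (if s.pilot i = t then ((√(s.pp i * s.vD i k) : ℝ) : ℂ) else 0) • (gD i) m := by
    refine Finset.sum_congr rfl fun n _ => ?_
    split_ifs <;> simp
  have h3 : (W *ᵥ s.pilotVec t) m = ∑ j, s.pilotVec t j • W m j := by
    simp [Matrix.mulVec, dotProduct, mul_comm]
  rw [h1, h2, h3]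
  ring

end System

/-- Each channel vector enters the observation of one pilot only, and the noise is rotated by a
unitary matrix. The rows of `obsCoeff` are therefore orthogonal for the weights `v`, and
uncorrelated jointly Gaussian vectors are independent. -/
theorem IsChannelModel.hasLaw_pilotObs {Ω : Type*} [MeasurableSpace Ω] {P : Measure Ω}
    [IsProbabilityMeasure P] {s : System N K M τ}
    {gD : Fin K → Ω → EuclideanSpace ℂ (Fin M)} {gC : Fin N → Ω → EuclideanSpace ℂ (Fin M)}
    {W : Ω → Matrix (Fin M) (Fin τ) ℂ} (h : IsChannelModel P s gD gC W) (k : Fin K) :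
    HasLaw (fun ω => s.pilotObs (s.receivedPilot k (fun i => gD i ω) (fun n => gC n ω) (W ω)))
      (Measure.pi fun t => complexNormalVec M (s.obsVar k t).toNNReal) P := by
  set v : Fin K ⊕ (Fin N ⊕ Fin τ) → ℝ≥0 :=
    Sum.elim (fun _ => 1) (Sum.elim (fun _ => 1) fun _ => s.N0.toNNReal) with hv
  have hjoint := h.indep.hasLaw_pi (μ := fun i => complexNormalVec M (v i)) (by
    rintro (i | n | t)
    · exact h.law_gD i
    · exact h.law_gC n
    · exact h.law_W t)
  have hsum : ∀ t u, ∑ i, (v i : ℂ) * (s.obsCoeff k t i * star (s.obsCoeff k u i))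
      = if t = u then (((s.obsVar k t).toNNReal : ℝ) : ℂ) else 0 := by
    intro t u
    have hN : ∑ j, s.pilotVec t j * star (s.pilotVec u j) = if t = u then 1 else 0 := by
      have h := s.star_pilotVec_dotProduct u t
      rw [dotProduct_comm] at h
      rw [← if_congr (eq_comm (a := u) (b := t)) rfl rfl]
      exact h
    have hi : ∀ {m : ℕ} (p : Fin m → Fin τ) (x : Fin m → ℝ), (∀ i, 0 ≤ x i) →
        ∑ i, ((if p i = t then ((√(x i) : ℝ) : ℂ) else 0) *
          star (if p i = u then ((√(x i) : ℝ) : ℂ) else 0))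
        = if t = u then ((∑ i with p i = t, x i : ℝ) : ℂ) else 0 := by
      intro m p x hx
      split_ifs with htu
      · subst htu
        rw [Finset.sum_filter, Complex.ofReal_sum]
        refine Finset.sum_congr rfl fun i _ => ?_
        split_ifs
        · rw [Complex.star_def, Complex.conj_ofReal, ← Complex.ofReal_mul,
            Real.mul_self_sqrt (hx i)]
        · simp
      · refine Finset.sum_eq_zero fun i _ => ?_
        by_cases h : p i = t
        · rw [if_neg (fun h' => htu (h.symm.trans h')), star_zero, mul_zero]
        · rw [if_neg h, zero_mul]
    simp only [Fintype.sum_sum_type, hv, System.obsCoeff, Sum.elim_inl, Sum.elim_inr,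
      NNReal.coe_one, Complex.ofReal_one, one_mul, ← Finset.mul_sum]
    rw [hN, hi s.pilot _ fun i => mul_nonneg (s.pp_nonneg i) (s.vD_nonneg i k),
      hi s.cuPilot _ fun n => mul_nonneg (s.qp_nonneg n) (s.vC_nonneg n k),
      Real.coe_toNNReal _ (s.obsVar_pos k t).le, Real.coe_toNNReal _ s.N0_pos.le]
    split_ifs
    · rw [System.obsVar]
      push_cast
      ring
    · simp
  have hmap := map_mulVec_pi_of_isComplexNormal
    (fun i => isComplexNormal_complexNormalVec M (v i))
    (fun t => isComplexNormal_complexNormalVec M (s.obsVar k t).toNNReal) (s.obsCoeff k)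
    (fun t => by rw [hsum, if_pos rfl]) (fun t u htu => by rw [hsum, if_neg htu])
  have hmeas : ∀ A : Fin τ → Fin K ⊕ (Fin N ⊕ Fin τ) → ℂ,
      Measurable fun (g : Fin K ⊕ (Fin N ⊕ Fin τ) → EuclideanSpace ℂ (Fin M)) t =>
        ∑ i, A t i • g i := fun A => by fun_prop
  have hlin : HasLaw (fun (g : Fin K ⊕ (Fin N ⊕ Fin τ) → EuclideanSpace ℂ (Fin M)) t =>
      ∑ i, s.obsCoeff k t i • g i) (Measure.pi fun t => complexNormalVec M (s.obsVar k t).toNNReal)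
      (Measure.pi fun i => complexNormalVec M (v i)) := ⟨(hmeas _).aemeasurable, hmap⟩
  refine (hlin.comp hjoint).congr (ae_of_all _ fun ω => ?_)
  funext t
  refine (s.pilotObs_receivedPilot k _ _ _ t).trans ?_
  refine Finset.sum_congr rfl fun i _ => ?_
  rcases i with i | n | t <;> rfl

end D2D

end

/-! ### The filter as a function of the observations; moments of the residual. -/

noncomputable section

namespace D2D

open scoped ENNReal

variable {N K M τ : ℕ}

namespace System

variable (s : System N K M τ)

theorem muD_nonneg (i k : Fin K) : 0 ≤ s.muD i k :=
  div_nonneg (mul_nonneg (s.pp_nonneg i) (s.vD_nonneg i k)) (s.pilotPowerD_pos i k).le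

theorem muC_nonneg (n : Fin N) (k : Fin K) : 0 ≤ s.muC n k :=
  div_nonneg (mul_nonneg (s.qp_nonneg n) (s.vC_nonneg n k))
    (add_nonneg (mul_nonneg (s.qp_nonneg n) (s.vC_nonneg n k)) s.N0_pos.le)

theorem epsD_nonneg (i k : Fin K) : 0 ≤ s.epsD i k := by
  rw [epsD, sub_nonneg, muD, div_le_one (s.pilotPowerD_pos i k), pilotPowerD]
  have h := Finset.single_le_sum (f := fun j => s.pp j * s.vD j k)
    (fun j _ => mul_nonneg (s.pp_nonneg j) (s.vD_nonneg j k))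
    (show i ∈ s.sharing i by simp [sharing])
  have := s.N0_pos
  linarith

theorem epsC_nonneg (n : Fin N) (k : Fin K) : 0 ≤ s.epsC n k := by
  have h1 := mul_nonneg (s.qp_nonneg n) (s.vC_nonneg n k)
  have h2 := s.N0_pos
  rw [epsC, sub_nonneg, muC, div_le_one (by linarith)]
  linarith

theorem alpha_pos (k : Fin K) : 0 < s.alpha k := by
  have h1 : 0 ≤ ∑ i, s.ps i * s.vD i k * s.epsD i k := Finset.sum_nonneg fun i _ =>
    mul_nonneg (mul_nonneg (s.ps_nonneg i) (s.vD_nonneg i k)) (s.epsD_nonneg i k)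
  have h2 : 0 ≤ ∑ n, s.qs n * s.vC n k * s.epsC n k := Finset.sum_nonneg fun n _ =>
    mul_nonneg (mul_nonneg (s.qs_nonneg n) (s.vC_nonneg n k)) (s.epsC_nonneg n k)
  have h3 := s.N0_pos
  rw [alpha]
  linarith

theorem pilotPowerD_congr {i k : Fin K} (h : s.pilot i = s.pilot k) :
    s.pilotPowerD i k = s.pilotPowerD k k := by
  rw [← s.obsVar_pilot, h, s.obsVar_pilot]

theorem estD_ofObs (k : Fin K) (z : Fin τ → EuclideanSpace ℂ (Fin M)) (i : Fin K) :
    s.estD k (s.ofObs z) i = ((√(s.pp i * s.vD i k) / s.pilotPowerD i k : ℝ) : ℂ) •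
      z (s.pilot i) := by
  rw [estD_eq, pilotObs_ofObs]

theorem estC_ofObs (k : Fin K) (z : Fin τ → EuclideanSpace ℂ (Fin M)) (n : Fin N) :
    s.estC k (s.ofObs z) n =
      ((√(s.qp n * s.vC n k) / (s.qp n * s.vC n k + s.N0) : ℝ) : ℂ) • z (s.cuPilot n) := by
  rw [estC_eq, pilotObs_ofObs]

theorem norm_inner_estD_sq (k i : Fin K) (z : Fin τ → EuclideanSpace ℂ (Fin M))
    (b : EuclideanSpace ℂ (Fin M)) :
    ‖inner ℂ b (s.estD k (s.ofObs z) i)‖ ^ 2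
      = s.muD i k / s.pilotPowerD i k * ‖inner ℂ b (z (s.pilot i))‖ ^ 2 := by
  rw [estD_ofObs, inner_smul_right, norm_mul, mul_pow, Complex.norm_real, Real.norm_eq_abs, sq_abs,
    div_pow, Real.sq_sqrt (mul_nonneg (s.pp_nonneg i) (s.vD_nonneg i k)), muD, div_div, pow_two]

theorem norm_inner_estC_sq (k : Fin K) (n : Fin N) (z : Fin τ → EuclideanSpace ℂ (Fin M))
    (b : EuclideanSpace ℂ (Fin M)) :
    ‖inner ℂ b (s.estC k (s.ofObs z) n)‖ ^ 2
      = s.muC n k / (s.qp n * s.vC n k + s.N0) * ‖inner ℂ b (z (s.cuPilot n))‖ ^ 2 := by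
  rw [estC_ofObs, inner_smul_right, norm_mul, mul_pow, Complex.norm_real, Real.norm_eq_abs, sq_abs,
    div_pow, Real.sq_sqrt (mul_nonneg (s.qp_nonneg n) (s.vC_nonneg n k)), muC, div_div, pow_two]

theorem measurable_estC_ofObs (k : Fin K) (n : Fin N) :
    Measurable fun z : Fin τ → EuclideanSpace ℂ (Fin M) => s.estC k (s.ofObs z) n := by
  simp_rw [s.estC_ofObs]
  fun_prop

theorem measurable_estD_ofObs (k i : Fin K) :
    Measurable fun z : Fin τ → EuclideanSpace ℂ (Fin M) => s.estD k (s.ofObs z) i := by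
  simp_rw [s.estD_ofObs]
  fun_prop

end System

namespace Cancellation

variable {s : System N K M τ} {mc md : ℕ} (c : Cancellation s mc md)

theorem mem_uncancelledC {n : Fin N} {k : Fin K} : n ∈ c.uncancelledC k ↔ n ∉ c.cus k := by
  simp [uncancelledC]

theorem mem_uncancelledD {i k : Fin K} : i ∈ c.uncancelledD k ↔ s.pilot i ∉ c.pilots k := by
  simp [uncancelledD]

/-- The indices of the pilots of the interferers that receiver `k` cancels. -/
def cancelledPilots (k : Fin K) : Finset (Fin τ) := (c.cus k).image s.cuPilot ∪ c.pilots k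

theorem card_cancelledPilots_le (k : Fin K) : (c.cancelledPilots k).card ≤ mc + md := by
  refine (Finset.card_union_le _ _).trans ?_
  rw [c.card_pilots, Finset.card_image_of_injective _ s.cuPilot_injective, c.card_cus]

theorem pilot_notMem_cancelledPilots {i k : Fin K} (h : i ∈ c.uncancelledD k) :
    s.pilot i ∉ c.cancelledPilots k := by
  simp [cancelledPilots, s.cuPilot_ne_pilot, c.mem_uncancelledD.1 h]

theorem self_mem_uncancelledD (k : Fin K) : k ∈ c.uncancelledD k :=
  c.mem_uncancelledD.2 (c.pilot_notMem k)

theorem cuPilot_notMem_cancelledPilots {n : Fin N} {k : Fin K} (h : n ∈ c.uncancelledC k) :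
    s.cuPilot n ∉ c.cancelledPilots k := by
  have h1 : s.cuPilot n ∉ c.pilots k := fun h' =>
    absurd n.2 (not_lt.2 (c.le_of_mem_pilots k _ h'))
  simp [cancelledPilots, h1, s.cuPilot_injective.eq_iff, c.mem_uncancelledC.1 h]

theorem cancelledSpan_ofObs (k : Fin K) (z : Fin τ → EuclideanSpace ℂ (Fin M)) :
    c.cancelledSpan k (s.ofObs z) = Submodule.span ℂ
      ((fun i => Sum.elim (s.estC k (s.ofObs z)) (s.estD k (s.ofObs z)) i) ''
        (((c.uncancelledC k)ᶜ.disjSum (c.uncancelledD k)ᶜ : Finset (Fin N ⊕ Fin K)) :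
          Set (Fin N ⊕ Fin K))) := by
  rw [cancelledSpan]
  congr 1
  ext x
  simp [eq_comm]

theorem cancelledSpan_ofObs_le (k : Fin K) (z : Fin τ → EuclideanSpace ℂ (Fin M)) :
    c.cancelledSpan k (s.ofObs z) ≤ Submodule.span ℂ ((c.cancelledPilots k).image z) := by
  rw [cancelledSpan, Submodule.span_le]
  rintro x (⟨n, hn, rfl⟩ | ⟨i, hi, rfl⟩)
  · rw [s.estC_ofObs]
    refine Submodule.smul_mem _ _ (Submodule.subset_span ?_)
    refine Finset.mem_coe.2 (Finset.mem_image_of_mem z ?_)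
    rw [mem_uncancelledC, not_not] at hn
    exact Finset.mem_union_left _ (Finset.mem_image_of_mem _ hn)
  · rw [s.estD_ofObs]
    refine Submodule.smul_mem _ _ (Submodule.subset_span ?_)
    refine Finset.mem_coe.2 (Finset.mem_image_of_mem z ?_)
    rw [mem_uncancelledD, not_not] at hi
    exact Finset.mem_union_right _ hi

/-- Transmitters that share a pilot have parallel estimates, so the dimension is governed by the
number of cancelled pilots, not of transmitters. It can be smaller, for instance when a pilot power
is zero. -/
theorem finrank_cancelledSpan_ofObs_le (k : Fin K) (z : Fin τ → EuclideanSpace ℂ (Fin M)) :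
    Module.finrank ℂ (c.cancelledSpan k (s.ofObs z)) ≤ mc + md :=
  (Submodule.finrank_mono (c.cancelledSpan_ofObs_le k z)).trans
    ((finrank_span_finset_le_card _).trans
      (Finset.card_image_le.trans (c.card_cancelledPilots_le k)))

/-- The pathwise form of the independence between the cancelled span and the observations of
uncancelled pilots. -/
theorem cancelledSpan_ofObs_update (k : Fin K) (z : Fin τ → EuclideanSpace ℂ (Fin M)) {t : Fin τ}
    (ht : t ∉ c.cancelledPilots k) (x : EuclideanSpace ℂ (Fin M)) :
    c.cancelledSpan k (s.ofObs (Function.update z t x)) = c.cancelledSpan k (s.ofObs z) := by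
  rw [cancelledSpan_ofObs, cancelledSpan_ofObs]
  congr 1
  refine Set.image_congr fun i hi => ?_
  rcases i with n | i
  · have hn : n ∈ c.cus k := by simpa [uncancelledC] using hi
    have : s.cuPilot n ≠ t := by
      rintro rfl
      exact ht (Finset.mem_union_left _ (Finset.mem_image_of_mem _ hn))
    simp [s.estC_ofObs, Function.update_of_ne this]
  · have hi' : s.pilot i ∈ c.pilots k := by simpa [uncancelledD] using hi
    have : s.pilot i ≠ t := by
      rintro rfl
      exact ht (Finset.mem_union_right _ hi')
    simp [s.estD_ofObs, Function.update_of_ne this]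

/-- The projection of the observation of pair `k` onto the orthogonal complement of the cancelled
estimates. -/
def residual (k : Fin K) (z : Fin τ → EuclideanSpace ℂ (Fin M)) : EuclideanSpace ℂ (Fin M) :=
  (c.cancelledSpan k (s.ofObs z))ᗮ.starProjection (z (s.pilot k))

theorem measurable_starProjection_cancelledSpan (k : Fin K)
    {g : (Fin τ → EuclideanSpace ℂ (Fin M)) → EuclideanSpace ℂ (Fin M)} (hg : Measurable g) :
    Measurable fun z => (c.cancelledSpan k (s.ofObs z))ᗮ.starProjection (g z) := by
  simp_rw [cancelledSpan_ofObs]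
  refine measurable_starProjection_orthogonal_span
    (f := fun i z => Sum.elim (s.estC k (s.ofObs z)) (s.estD k (s.ofObs z)) i) ?_ _ hg
  rintro (n | i)
  · exact s.measurable_estC_ofObs k n
  · exact s.measurable_estD_ofObs k i

theorem measurable_residual (k : Fin K) : Measurable (c.residual k) :=
  c.measurable_starProjection_cancelledSpan k (measurable_pi_apply _)

theorem measurable_filter_ofObs (k : Fin K) : Measurable fun z => c.filter k (s.ofObs z) := by
  have h := c.measurable_starProjection_cancelledSpan k (s.measurable_estD_ofObs k k)
  exact (Complex.measurable_ofReal.comp h.norm.inv).smul h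

theorem measurable_sinr_ofObs (k : Fin K) : Measurable fun z => c.sinr k (s.ofObs z) := by
  have h := c.measurable_filter_ofObs k
  refine Measurable.div ?_ (((Finset.measurable_sum _ fun i _ => ?_).add
    (Finset.measurable_sum _ fun n _ => ?_)).add ?_)
  · exact ((h.inner (s.measurable_estD_ofObs k k)).norm.pow_const 2).const_mul _
  · exact ((h.inner (s.measurable_estD_ofObs k i)).norm.pow_const 2).const_mul _
  · exact ((h.inner (s.measurable_estC_ofObs k n)).norm.pow_const 2).const_mul _
  · exact (h.norm.pow_const 2).const_mul _

theorem inner_residual_self (k : Fin K) (z : Fin τ → EuclideanSpace ℂ (Fin M)) :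
    inner ℂ (c.residual k z) (z (s.pilot k)) = ((‖c.residual k z‖ ^ 2 : ℝ) : ℂ) := by
  have h : (c.cancelledSpan k (s.ofObs z))ᗮ.starProjection (c.residual k z) = c.residual k z :=
    Submodule.starProjection_eq_self_iff.2 (Submodule.starProjection_apply_mem _ _)
  have h2 := inner_self_eq_norm_sq_to_K (𝕜 := ℂ) (c.residual k z)
  rw [← h, Submodule.inner_starProjection_left_eq_right]
  rw [Complex.ofReal_pow, h]
  exact h2

/-- The estimate is a positive multiple of the observation when `muD` is positive, and normalization
removes the factor. -/
theorem filter_ofObs (k : Fin K) (z : Fin τ → EuclideanSpace ℂ (Fin M)) (h : 0 < s.muD k k) :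
    c.filter k (s.ofObs z) = ((‖c.residual k z‖⁻¹ : ℝ) : ℂ) • c.residual k z := by
  have hP := s.pilotPowerD_pos k k
  have ha : 0 < √(s.pp k * s.vD k k) / s.pilotPowerD k k := by
    refine div_pos (Real.sqrt_pos.2 ?_) hP
    rw [System.muD] at h
    exact (div_pos_iff_of_pos_right hP).1 h
  rw [filter, s.estD_ofObs]
  set a := √(s.pp k * s.vD k k) / s.pilotPowerD k k
  simp only [map_smul]
  change ((‖(a : ℂ) • c.residual k z‖⁻¹ : ℝ) : ℂ) • (a : ℂ) • c.residual k z = _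
  rw [norm_smul, smul_smul, ← Complex.ofReal_mul, Complex.norm_real, Real.norm_of_nonneg ha.le]
  congr 2
  rw [mul_inv, mul_comm, ← mul_assoc, mul_inv_cancel₀ ha.ne', one_mul]

theorem norm_inner_filter_sq (k : Fin K) (z : Fin τ → EuclideanSpace ℂ (Fin M))
    (h : 0 < s.muD k k) (x : EuclideanSpace ℂ (Fin M)) :
    ‖inner ℂ (c.filter k (s.ofObs z)) x‖ ^ 2
      = ‖inner ℂ (c.residual k z) x‖ ^ 2 / ‖c.residual k z‖ ^ 2 := by
  rw [c.filter_ofObs k z h, inner_smul_left, norm_mul, mul_pow, Complex.conj_ofReal,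
    Complex.norm_real, norm_inv, norm_norm, inv_pow, mul_comm, div_eq_mul_inv]

/-- The law of the correlations of the received pilot matrix with the pilots. -/
abbrev obsLaw (s : System N K M τ) (k : Fin K) : Measure (Fin τ → EuclideanSpace ℂ (Fin M)) :=
  Measure.pi fun t => complexNormalVec M (s.obsVar k t).toNNReal

/-- With all other observations fixed, the cancelled span is a fixed subspace and only the own
observation is random. -/
theorem lintegral_inv_norm_residual_sq_le (hM : mc + md + 2 ≤ M) (k : Fin K) :
    ∫⁻ z, (ENNReal.ofReal (‖c.residual k z‖ ^ 2))⁻¹ ∂obsLaw s k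
      ≤ ENNReal.ofReal (1 / (s.pilotPowerD k k * c.dof)) := by
  have hm : Measurable fun z => (ENNReal.ofReal (‖c.residual k z‖ ^ 2))⁻¹ :=
    ((c.measurable_residual k).norm.pow_const 2).ennreal_ofReal.inv
  rw [lintegral_pi_eq_lintegral_update _ hm (s.pilot k)]
  calc _ ≤ ∫⁻ _, ENNReal.ofReal (1 / (s.pilotPowerD k k * c.dof)) ∂obsLaw s k := by
        refine lintegral_mono fun z => ?_
        have hv : (s.obsVar k (s.pilot k)).toNNReal ≠ 0 := by
          simpa using s.obsVar_pos k (s.pilot k)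
        have h := lintegral_inv_norm_starProjection_sq_le hv hM (c.cancelledSpan k (s.ofObs z))
          (c.finrank_cancelledSpan_ofObs_le k z)
        rw [Real.coe_toNNReal _ (s.obsVar_pos k _).le, s.obsVar_pilot] at h
        simp only [residual, Function.update_self, c.cancelledSpan_ofObs_update k z
          (c.pilot_notMem_cancelledPilots (c.self_mem_uncancelledD k))]
        rw [s.obsVar_pilot] at *
        refine h.trans (le_of_eq ?_)
        rw [dof]
        push_cast
        congr 3
        ring
    _ = _ := by simp

/-- The received power of the observation of index `t`, relative to the square of the received
power of the observation of pair `k`. -/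
def relativePower (k : Fin K) (t : Fin τ) (z : Fin τ → EuclideanSpace ℂ (Fin M)) : ℝ≥0∞ :=
  ENNReal.ofReal (‖inner ℂ (c.residual k z) (z t)‖ ^ 2) *
    ((ENNReal.ofReal (‖c.residual k z‖ ^ 2))⁻¹ * (ENNReal.ofReal (‖c.residual k z‖ ^ 2))⁻¹)

theorem measurable_relativePower (k : Fin K) (t : Fin τ) : Measurable (c.relativePower k t) := by
  have h := c.measurable_residual k
  have h1 := ((Measurable.inner (𝕜 := ℂ) h (measurable_pi_apply t)).norm.pow_const 2).ennreal_ofReal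
  have h2 := (h.norm.pow_const 2).ennreal_ofReal.inv
  exact h1.mul (h2.mul h2)

/-- A projection is self-adjoint and idempotent, so the correlation of the residual with its own
observation is `‖r‖²` and the quotient is 1, or 0 where `r = 0`. -/
theorem lintegral_relativePower_self_le (k : Fin K) :
    ∫⁻ z, c.relativePower k (s.pilot k) z ∂obsLaw s k ≤ 1 := by
  calc _ ≤ ∫⁻ _, 1 ∂obsLaw s k := by
        refine lintegral_mono fun z => ?_
        rw [relativePower, inner_residual_self, Complex.norm_real, norm_pow, norm_norm, pow_two (_ ^ 2),
          ENNReal.ofReal_mul (by positivity), mul_mul_mul_comm]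
        exact mul_le_one' (ENNReal.mul_inv_le_one _) (ENNReal.mul_inv_le_one _)
    _ = 1 := by simp

/-- Changing `z t` affects neither the cancelled span nor the own observation, so the residual is
constant in the inner integral. There `|⟨r, z t⟩|²` has mean `obsVar * ‖r‖²`, which cancels one of
the two factors `1 / ‖r‖²`. -/
theorem lintegral_relativePower_le (hM : mc + md + 2 ≤ M) (k : Fin K) {t : Fin τ}
    (ht : t ∉ c.cancelledPilots k) (htk : t ≠ s.pilot k) :
    ∫⁻ z, c.relativePower k t z ∂obsLaw s k
      ≤ ENNReal.ofReal (s.obsVar k t / (s.pilotPowerD k k * c.dof)) := by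
  have hv := s.obsVar_pos k t
  rw [lintegral_pi_eq_lintegral_update _ (c.measurable_relativePower k t) t]
  calc _ ≤ ∫⁻ z, ENNReal.ofReal (s.obsVar k t) * (ENNReal.ofReal (‖c.residual k z‖ ^ 2))⁻¹
        ∂obsLaw s k := by
        refine lintegral_mono fun z => ?_
        have hres : ∀ x, c.residual k (Function.update z t x) = c.residual k z := fun x => by
          simp only [residual, c.cancelledSpan_ofObs_update k z ht,
            Function.update_of_ne htk.symm]
        simp only [relativePower, hres, Function.update_self]
        rw [lintegral_mul_const _ (by fun_prop), lintegral_norm_inner_sq_complexNormalVec,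
          Real.coe_toNNReal _ hv.le, ENNReal.ofReal_mul hv.le, mul_assoc, ← mul_assoc
          (ENNReal.ofReal (‖c.residual k z‖ ^ 2))]
        refine mul_le_mul_right ?_ _
        exact (mul_le_mul_left (ENNReal.mul_inv_le_one _) _).trans (one_mul _).le
    _ = ENNReal.ofReal (s.obsVar k t) * ∫⁻ z, (ENNReal.ofReal (‖c.residual k z‖ ^ 2))⁻¹
        ∂obsLaw s k :=
        lintegral_const_mul _ ((c.measurable_residual k).norm.pow_const 2).ennreal_ofReal.inv
    _ ≤ ENNReal.ofReal (s.obsVar k t) * ENNReal.ofReal (1 / (s.pilotPowerD k k * c.dof)) :=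
        mul_le_mul_right (c.lintegral_inv_norm_residual_sq_le hM k) _
    _ = _ := by rw [← ENNReal.ofReal_mul hv.le, mul_one_div]

end Cancellation

end D2D

end

/-! ### Integrability of the rate, the mean of 1/SINR, and the logarithmic bound. -/

noncomputable section

namespace D2D

open scoped ENNReal

variable {N K M τ : ℕ}

namespace Cancellation

variable {s : System N K M τ} {mc md : ℕ} (c : Cancellation s mc md)

theorem signal_nonneg (k : Fin K) (Y : Matrix (Fin M) (Fin τ) ℂ) : 0 ≤ c.signal k Y :=
  mul_nonneg (mul_nonneg (s.ps_nonneg k) (s.vD_nonneg k k)) (sq_nonneg _)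

theorem interferenceD_nonneg (k : Fin K) (Y : Matrix (Fin M) (Fin τ) ℂ) :
    0 ≤ c.interferenceD k Y :=
  Finset.sum_nonneg fun i _ => mul_nonneg (mul_nonneg (s.ps_nonneg i) (s.vD_nonneg i k)) (sq_nonneg _)

theorem interferenceC_nonneg (k : Fin K) (Y : Matrix (Fin M) (Fin τ) ℂ) :
    0 ≤ c.interferenceC k Y :=
  Finset.sum_nonneg fun n _ => mul_nonneg (mul_nonneg (s.qs_nonneg n) (s.vC_nonneg n k)) (sq_nonneg _)

theorem sinr_nonneg (k : Fin K) (Y : Matrix (Fin M) (Fin τ) ℂ) : 0 ≤ c.sinr k Y :=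
  div_nonneg (c.signal_nonneg k Y) (add_nonneg
    (add_nonneg (c.interferenceD_nonneg k Y) (c.interferenceC_nonneg k Y))
    (mul_nonneg (s.alpha_pos k).le (sq_nonneg _)))

/-- Drop the interference and apply Cauchy–Schwarz. This majorant has finite mean, which makes the
logarithm integrable. -/
theorem sinr_le (k : Fin K) (Y : Matrix (Fin M) (Fin τ) ℂ) :
    c.sinr k Y ≤ s.ps k * s.vD k k * ‖s.estD k Y k‖ ^ 2 / s.alpha k := by
  have hα := s.alpha_pos k
  have hpv := mul_nonneg (s.ps_nonneg k) (s.vD_nonneg k k)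
  rcases eq_or_ne (c.filter k Y) 0 with h0 | h0
  · rw [sinr, signal, h0]
    simp only [inner_zero_left, norm_zero, ne_eq, OfNat.ofNat_ne_zero, not_false_eq_true, zero_pow,
      mul_zero, zero_div]
    positivity
  · have hn : 0 < ‖c.filter k Y‖ := norm_pos_iff.2 h0
    have h1 := c.interferenceD_nonneg k Y
    have h2 := c.interferenceC_nonneg k Y
    calc c.sinr k Y ≤ s.ps k * s.vD k k * (‖c.filter k Y‖ * ‖s.estD k Y k‖) ^ 2
          / (s.alpha k * ‖c.filter k Y‖ ^ 2) := by
          refine div_le_div₀ (by positivity) ?_ (by positivity) (by linarith)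
          exact mul_le_mul_of_nonneg_left
            (pow_le_pow_left₀ (norm_nonneg _) (norm_inner_le_norm _ _) 2) hpv
      _ = _ := by field_simp

theorem integrable_log_one_add_sinr (k : Fin K) :
    Integrable (fun z => Real.log (1 + c.sinr k (s.ofObs z))) (obsLaw s k) := by
  have hsq : Integrable (fun x : EuclideanSpace ℂ (Fin M) => ‖x‖ ^ 2)
      (complexNormalVec M (s.obsVar k (s.pilot k)).toNNReal) := by
    refine ⟨by fun_prop, ?_⟩
    rw [hasFiniteIntegral_iff_ofReal (ae_of_all _ fun x => sq_nonneg _)]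
    exact lintegral_norm_sq_complexNormalVec_lt_top _
  have hest : Integrable (fun z => s.ps k * s.vD k k * ‖s.estD k (s.ofObs z) k‖ ^ 2 / s.alpha k)
      (obsLaw (M := M) s k) := by
    have h := (measurePreserving_eval (fun t => complexNormalVec M (s.obsVar k t).toNNReal)
      (s.pilot k)).integrable_comp_of_integrable hsq
    simp_rw [s.estD_ofObs, norm_smul, mul_pow]
    exact ((h.const_mul _).const_mul _).div_const _
  refine hest.mono' ((c.measurable_sinr_ofObs k).const_add 1).log.aestronglyMeasurable
    (ae_of_all _ fun z => ?_)
  have h0 := c.sinr_nonneg k (s.ofObs z)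
  rw [Real.norm_of_nonneg (Real.log_nonneg (by linarith))]
  have h1 := Real.log_le_sub_one_of_pos (show 0 < 1 + c.sinr k (s.ofObs z) by linarith)
  have h2 := c.sinr_le k (s.ofObs z)
  linarith

theorem dof_nonneg (hM : mc + md + 1 ≤ M) : 0 ≤ c.dof := by
  have : ((mc + md + 1 : ℕ) : ℝ) ≤ M := by exact_mod_cast hM
  push_cast at this
  rw [dof]
  linarith

theorem ofReal_inner_div_eq_relativePower (k : Fin K) (t : Fin τ)
    (z : Fin τ → EuclideanSpace ℂ (Fin M)) (hw : c.residual k z ≠ 0) :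
    ENNReal.ofReal (‖inner ℂ (c.residual k z) (z t)‖ ^ 2 / (‖c.residual k z‖ ^ 2) ^ 2)
      = c.relativePower k t z := by
  have hr : 0 < ‖c.residual k z‖ ^ 2 := by positivity
  rw [relativePower, ← ENNReal.ofReal_inv_of_pos hr, ← ENNReal.ofReal_mul (by positivity),
    ← ENNReal.ofReal_mul (by positivity), ← mul_inv, ← pow_two, div_eq_mul_inv]

/-- The interference caused by the uncancelled D2D transmitter `i`, relative to the received
power of pair `k`, is bounded in mean. -/
theorem lintegral_relativePower_pilot_le (hM : mc + md + 2 ≤ M) (hdof : 0 < c.dof) {i k : Fin K}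
    (hi : i ∈ c.uncancelledD k \ {k}) :
    ENNReal.ofReal (s.vD i k * (s.muD i k / s.pilotPowerD i k)) *
        ∫⁻ z, c.relativePower k (s.pilot i) z ∂obsLaw s k
      ≤ ENNReal.ofReal ((c.psi i k - s.vD i k * s.epsD i k) / (s.pilotPowerD k k * c.dof)) := by
  obtain ⟨hiD, hik⟩ := Finset.mem_sdiff.1 hi
  rw [Finset.mem_singleton] at hik
  have hP := s.pilotPowerD_pos k k
  have hPi := s.pilotPowerD_pos i k
  have h0 : 0 ≤ s.vD i k * (s.muD i k / s.pilotPowerD i k) :=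
    mul_nonneg (s.vD_nonneg i k) (div_nonneg (s.muD_nonneg i k) hPi.le)
  have hnot : ¬(i = k ∨ i ∉ c.uncancelledD k) := by tauto
  by_cases hsh : s.pilot i = s.pilot k
  · rw [psi, if_neg hnot, if_pos (by simpa [System.sharing] using hsh), hsh,
      s.pilotPowerD_congr hsh]
    -- Pilot contamination: the quotient has mean at most 1, and the factor `dof` in `psi` cancels
    -- the one in the denominator.
    refine (mul_le_of_le_one_right' (c.lintegral_relativePower_self_le k)).trans
      (ENNReal.ofReal_le_ofReal (le_of_eq ?_))
    field_simp
    ring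
  · rw [psi, if_neg hnot, if_neg (by simpa [System.sharing] using hsh)]
    -- The variance `pilotPowerD i k` of the observation cancels the same factor in the coefficient
    -- and leaves `v * mu = v - v * eps`.
    refine (mul_le_mul_right (c.lintegral_relativePower_le hM k
      (c.pilot_notMem_cancelledPilots hiD) hsh) _).trans ?_
    rw [← ENNReal.ofReal_mul h0, s.obsVar_pilot]
    refine ENNReal.ofReal_le_ofReal (le_of_eq ?_)
    rw [System.epsD]
    field_simp
    ring

theorem lintegral_relativePower_cuPilot_le (hM : mc + md + 2 ≤ M) {n : Fin N} {k : Fin K}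
    (hn : n ∈ c.uncancelledC k) :
    ENNReal.ofReal (s.vC n k * (s.muC n k / (s.qp n * s.vC n k + s.N0))) *
        ∫⁻ z, c.relativePower k (s.cuPilot n) z ∂obsLaw s k
      ≤ ENNReal.ofReal (s.vC n k * s.muC n k / (s.pilotPowerD k k * c.dof)) := by
  have hc := s.obsVar_pos k (s.cuPilot n)
  rw [s.obsVar_cuPilot] at hc
  have h0 : 0 ≤ s.vC n k * (s.muC n k / (s.qp n * s.vC n k + s.N0)) :=
    mul_nonneg (s.vC_nonneg n k) (div_nonneg (s.muC_nonneg n k) hc.le)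
  refine (mul_le_mul_right (c.lintegral_relativePower_le hM k
    (c.cuPilot_notMem_cancelledPilots hn) (s.cuPilot_ne_pilot n k)) _).trans ?_
  rw [← ENNReal.ofReal_mul h0, s.obsVar_cuPilot]
  refine ENNReal.ofReal_le_ofReal (le_of_eq ?_)
  generalize s.qp n * s.vC n k + s.N0 = q at hc
  field_simp

theorem psi_sub_nonneg (hdof : 0 ≤ c.dof) (i k : Fin K) :
    0 ≤ c.psi i k - s.vD i k * s.epsD i k := by
  have h1 := s.muD_nonneg i k
  have h2 := s.vD_nonneg i k
  rw [psi]
  split_ifs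
  · simp
  · rw [add_sub_cancel_right]
    positivity
  · rw [System.epsD]
    nlinarith [mul_nonneg h1 h2]

/-- `alpha` already contains the error terms of all transmitters, cancelled or not. Separating it
from `psi` and `sigma` leaves only the interference received through the estimates. -/
theorem sum_psi_add_sigma (k : Fin K) :
    ∑ i, s.ps i * c.psi i k + c.sigma k
      = ∑ i ∈ c.uncancelledD k \ {k}, s.ps i * (c.psi i k - s.vD i k * s.epsD i k)
        + ∑ n ∈ c.uncancelledC k, s.qs n * (s.vC n k * s.muC n k) + s.alpha k := by
  have h1 : ∑ i, s.ps i * c.psi i k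
      = ∑ i ∈ c.uncancelledD k \ {k}, s.ps i * (c.psi i k - s.vD i k * s.epsD i k)
        + ∑ i, s.ps i * s.vD i k * s.epsD i k := by
    rw [Finset.sum_subset (Finset.subset_univ (c.uncancelledD k \ {k})), ← Finset.sum_add_distrib]
    · exact Finset.sum_congr rfl fun i _ => by ring
    · intro i _ hi
      have : i = k ∨ i ∉ c.uncancelledD k := by
        rw [Finset.mem_sdiff, Finset.mem_singleton] at hi
        tauto
      rw [psi, if_pos this, sub_self, mul_zero]
  have h2 : ∑ n, s.qs n * s.vC n k * s.epsC n k
      = ∑ n ∈ c.uncancelledC k, s.qs n * s.vC n k * s.epsC n k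
        + ∑ n ∈ (c.uncancelledC k)ᶜ, s.qs n * s.vC n k * s.epsC n k :=
    (Finset.sum_add_sum_compl _ _).symm
  have h3 : ∑ n ∈ c.uncancelledC k, s.qs n * s.vC n k
      = ∑ n ∈ c.uncancelledC k, s.qs n * (s.vC n k * s.muC n k)
        + ∑ n ∈ c.uncancelledC k, s.qs n * s.vC n k * s.epsC n k := by
    rw [← Finset.sum_add_distrib]
    refine Finset.sum_congr rfl fun n _ => ?_
    rw [System.epsC]
    ring
  rw [sigma, System.alpha, h1, h2, h3]
  ring

/-- The interference and noise after partial zero forcing, divided by the power of the residual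
of pair `k`. -/
def interferenceRatio (k : Fin K) (z : Fin τ → EuclideanSpace ℂ (Fin M)) : ℝ :=
  ∑ i ∈ c.uncancelledD k \ {k}, s.ps i * (s.vD i k * (s.muD i k / s.pilotPowerD i k)) *
        (‖inner ℂ (c.residual k z) (z (s.pilot i))‖ ^ 2 / (‖c.residual k z‖ ^ 2) ^ 2)
    + ∑ n ∈ c.uncancelledC k, s.qs n * (s.vC n k * (s.muC n k / (s.qp n * s.vC n k + s.N0))) *
        (‖inner ℂ (c.residual k z) (z (s.cuPilot n))‖ ^ 2 / (‖c.residual k z‖ ^ 2) ^ 2)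
    + s.alpha k * (‖c.residual k z‖ ^ 2)⁻¹

theorem measurable_interferenceRatio (k : Fin K) : Measurable (c.interferenceRatio k) := by
  have h := c.measurable_residual k
  have h1 := h.norm.pow_const 2
  have h2 : ∀ t, Measurable fun z => ‖inner ℂ (c.residual k z) (z t)‖ ^ 2 := fun t =>
    (Measurable.inner (𝕜 := ℂ) h (measurable_pi_apply t)).norm.pow_const 2
  refine ((Finset.measurable_sum _ fun i _ => ?_).add
    (Finset.measurable_sum _ fun n _ => ?_)).add (h1.inv.const_mul _)
  · exact ((h2 _).div (h1.pow_const 2)).const_mul _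
  · exact ((h2 _).div (h1.pow_const 2)).const_mul _

theorem interferenceRatio_pos (k : Fin K) (z : Fin τ → EuclideanSpace ℂ (Fin M))
    (hw : c.residual k z ≠ 0) : 0 < c.interferenceRatio k z := by
  have hr : 0 < ‖c.residual k z‖ ^ 2 := by positivity
  refine add_pos_of_nonneg_of_pos (add_nonneg (Finset.sum_nonneg fun i _ => ?_)
    (Finset.sum_nonneg fun n _ => ?_)) (mul_pos (s.alpha_pos k) (inv_pos.2 hr))
  · have h1 := s.ps_nonneg i
    have h2 := s.vD_nonneg i k
    have h3 := s.muD_nonneg i k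
    have h4 := s.pilotPowerD_pos i k
    positivity
  · have h1 := s.qs_nonneg n
    have h2 := s.vC_nonneg n k
    have h3 := s.muC_nonneg n k
    have h4 := s.obsVar_pos k (s.cuPilot n)
    rw [s.obsVar_cuPilot] at h4
    positivity

theorem sinr_ofObs (k : Fin K) (z : Fin τ → EuclideanSpace ℂ (Fin M)) (hμ : 0 < s.muD k k)
    (hw : c.residual k z ≠ 0) :
    c.sinr k (s.ofObs z)
      = (c.interferenceRatio k z / (s.ps k * s.vD k k * (s.muD k k / s.pilotPowerD k k)))⁻¹ := by
  have hr : 0 < ‖c.residual k z‖ ^ 2 := by positivity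
  have hnorm : ‖c.filter k (s.ofObs z)‖ ^ 2 = 1 := by
    rw [c.filter_ofObs k z hμ, norm_smul, Complex.norm_real, norm_inv, norm_norm,
      inv_mul_cancel₀ (norm_ne_zero_iff.2 hw), one_pow]
  have hsig : c.signal k (s.ofObs z)
      = s.ps k * s.vD k k * (s.muD k k / s.pilotPowerD k k) * ‖c.residual k z‖ ^ 2 := by
    rw [signal, s.norm_inner_estD_sq, c.norm_inner_filter_sq k z hμ, inner_residual_self,
      Complex.norm_real, norm_pow, norm_norm]
    field_simp
  have hden : c.interferenceD k (s.ofObs z) + c.interferenceC k (s.ofObs z)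
      + s.alpha k * ‖c.filter k (s.ofObs z)‖ ^ 2
      = c.interferenceRatio k z * ‖c.residual k z‖ ^ 2 := by
    rw [hnorm, interferenceRatio, add_mul, add_mul, Finset.sum_mul, Finset.sum_mul, mul_assoc,
      inv_mul_cancel₀ hr.ne', interferenceD, interferenceC]
    congr 2
    · refine Finset.sum_congr rfl fun i _ => ?_
      rw [s.norm_inner_estD_sq, c.norm_inner_filter_sq k z hμ]
      field_simp
    · refine Finset.sum_congr rfl fun n _ => ?_
      rw [s.norm_inner_estC_sq, c.norm_inner_filter_sq k z hμ]
      field_simp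
  rw [sinr, hsig, hden, mul_div_mul_right _ _ hr.ne', inv_div]

/-- A finite mean of `1 / ‖r‖²` excludes `r = 0` outside a null set. -/
theorem residual_ne_zero_ae (hM : mc + md + 2 ≤ M) (k : Fin K) :
    ∀ᵐ z ∂obsLaw s k, c.residual k z ≠ 0 := by
  have hm : Measurable fun z => (ENNReal.ofReal (‖c.residual k z‖ ^ 2))⁻¹ :=
    ((c.measurable_residual k).norm.pow_const 2).ennreal_ofReal.inv
  have h := ae_lt_top hm
    ((c.lintegral_inv_norm_residual_sq_le hM k).trans_lt ENNReal.ofReal_lt_top).ne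
  filter_upwards [h] with z hz h0
  simp [h0] at hz

theorem lintegral_interferenceRatio_le (hM : mc + md + 2 ≤ M) (hdof : 0 < c.dof) (k : Fin K) :
    ∫⁻ z, ENNReal.ofReal (c.interferenceRatio k z) ∂obsLaw s k
      ≤ ENNReal.ofReal ((∑ i, s.ps i * c.psi i k + c.sigma k) /
        (s.pilotPowerD k k * c.dof)) := by
  have hP := s.pilotPowerD_pos k k
  set A : Fin K → ℝ := fun i => s.vD i k * (s.muD i k / s.pilotPowerD i k) with hA
  set B : Fin N → ℝ := fun n => s.vC n k * (s.muC n k / (s.qp n * s.vC n k + s.N0)) with hB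
  have hA0 : ∀ i, 0 ≤ A i := fun i =>
    mul_nonneg (s.vD_nonneg i k) (div_nonneg (s.muD_nonneg i k) (s.pilotPowerD_pos i k).le)
  have hB0 : ∀ n, 0 ≤ B n := fun n => by
    have h4 := s.obsVar_pos k (s.cuPilot n)
    rw [s.obsVar_cuPilot] at h4
    exact mul_nonneg (s.vC_nonneg n k) (div_nonneg (s.muC_nonneg n k) h4.le)
  have hm : Measurable fun z => (ENNReal.ofReal (‖c.residual k z‖ ^ 2))⁻¹ :=
    ((c.measurable_residual k).norm.pow_const 2).ennreal_ofReal.inv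
  calc ∫⁻ z, ENNReal.ofReal (c.interferenceRatio k z) ∂obsLaw s k
      = ∫⁻ z, (∑ i ∈ c.uncancelledD k \ {k},
            ENNReal.ofReal (s.ps i) * ENNReal.ofReal (A i) * c.relativePower k (s.pilot i) z
          + ∑ n ∈ c.uncancelledC k,
            ENNReal.ofReal (s.qs n) * ENNReal.ofReal (B n) * c.relativePower k (s.cuPilot n) z
          + ENNReal.ofReal (s.alpha k) * (ENNReal.ofReal (‖c.residual k z‖ ^ 2))⁻¹)
          ∂obsLaw s k := by
        -- Only where `r ≠ 0` does the real inverse agree with the extended one, which is infinite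
        -- at 0.
        refine lintegral_congr_ae ?_
        filter_upwards [c.residual_ne_zero_ae hM k] with z hw
        have hr : 0 < ‖c.residual k z‖ ^ 2 := by positivity
        have hD : ∀ i, 0 ≤ s.ps i * A i *
            (‖inner ℂ (c.residual k z) (z (s.pilot i))‖ ^ 2 / (‖c.residual k z‖ ^ 2) ^ 2) :=
          fun i => mul_nonneg (mul_nonneg (s.ps_nonneg i) (hA0 i)) (by positivity)
        have hC : ∀ n, 0 ≤ s.qs n * B n *
            (‖inner ℂ (c.residual k z) (z (s.cuPilot n))‖ ^ 2 / (‖c.residual k z‖ ^ 2) ^ 2) :=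
          fun n => mul_nonneg (mul_nonneg (s.qs_nonneg n) (hB0 n)) (by positivity)
        rw [interferenceRatio, ENNReal.ofReal_add (add_nonneg (Finset.sum_nonneg fun i _ => hD i)
            (Finset.sum_nonneg fun n _ => hC n)) (mul_nonneg (s.alpha_pos k).le (inv_pos.2 hr).le),
          ENNReal.ofReal_add (Finset.sum_nonneg fun i _ => hD i) (Finset.sum_nonneg fun n _ => hC n),
          ENNReal.ofReal_sum_of_nonneg fun i _ => hD i, ENNReal.ofReal_sum_of_nonneg fun n _ => hC n,
          ENNReal.ofReal_mul (s.alpha_pos k).le, ENNReal.ofReal_inv_of_pos hr]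
        congr 2
        · refine Finset.sum_congr rfl fun i _ => ?_
          rw [← c.ofReal_inner_div_eq_relativePower k _ z hw, ENNReal.ofReal_mul
            (mul_nonneg (s.ps_nonneg i) (hA0 i)), ENNReal.ofReal_mul (s.ps_nonneg i)]
        · refine Finset.sum_congr rfl fun n _ => ?_
          rw [← c.ofReal_inner_div_eq_relativePower k _ z hw, ENNReal.ofReal_mul
            (mul_nonneg (s.qs_nonneg n) (hB0 n)), ENNReal.ofReal_mul (s.qs_nonneg n)]
    _ = ∑ i ∈ c.uncancelledD k \ {k}, ENNReal.ofReal (s.ps i) *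
            (ENNReal.ofReal (A i) * ∫⁻ z, c.relativePower k (s.pilot i) z ∂obsLaw s k)
          + ∑ n ∈ c.uncancelledC k, ENNReal.ofReal (s.qs n) *
            (ENNReal.ofReal (B n) * ∫⁻ z, c.relativePower k (s.cuPilot n) z ∂obsLaw s k)
          + ENNReal.ofReal (s.alpha k) *
            ∫⁻ z, (ENNReal.ofReal (‖c.residual k z‖ ^ 2))⁻¹ ∂obsLaw s k := by
        rw [lintegral_add_right _ (hm.const_mul _), lintegral_add_right _
          (Finset.measurable_sum _ fun n _ => (c.measurable_relativePower k _).const_mul _),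
          lintegral_finsetSum _ fun i _ => (c.measurable_relativePower k _).const_mul _,
          lintegral_finsetSum _ fun n _ => (c.measurable_relativePower k _).const_mul _,
          lintegral_const_mul _ hm]
        simp_rw [lintegral_const_mul _ (c.measurable_relativePower k _), mul_assoc]
    _ ≤ ∑ i ∈ c.uncancelledD k \ {k}, ENNReal.ofReal (s.ps i) *
            ENNReal.ofReal ((c.psi i k - s.vD i k * s.epsD i k) / (s.pilotPowerD k k * c.dof))
          + ∑ n ∈ c.uncancelledC k, ENNReal.ofReal (s.qs n) *
            ENNReal.ofReal (s.vC n k * s.muC n k / (s.pilotPowerD k k * c.dof))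
          + ENNReal.ofReal (s.alpha k) * ENNReal.ofReal (1 / (s.pilotPowerD k k * c.dof)) := by
        refine add_le_add (add_le_add (Finset.sum_le_sum fun i hi => ?_)
          (Finset.sum_le_sum fun n hn => ?_)) ?_
        · exact mul_le_mul_right (c.lintegral_relativePower_pilot_le hM hdof hi) _
        · exact mul_le_mul_right (c.lintegral_relativePower_cuPilot_le hM hn) _
        · exact mul_le_mul_right (c.lintegral_inv_norm_residual_sq_le hM k) _
    _ = _ := by
        have hD : ∀ i, 0 ≤ s.ps i *
            ((c.psi i k - s.vD i k * s.epsD i k) / (s.pilotPowerD k k * c.dof)) := fun i =>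
          mul_nonneg (s.ps_nonneg i) (div_nonneg (c.psi_sub_nonneg hdof.le i k) (by positivity))
        have hC : ∀ n, 0 ≤ s.qs n * (s.vC n k * s.muC n k / (s.pilotPowerD k k * c.dof)) := fun n =>
          mul_nonneg (s.qs_nonneg n)
            (div_nonneg (mul_nonneg (s.vC_nonneg n k) (s.muC_nonneg n k)) (by positivity))
        simp_rw [← ENNReal.ofReal_mul (s.ps_nonneg _), ← ENNReal.ofReal_mul (s.qs_nonneg _)]
        rw [← ENNReal.ofReal_mul (s.alpha_pos k).le, ← ENNReal.ofReal_sum_of_nonneg fun i _ => hD i,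
          ← ENNReal.ofReal_sum_of_nonneg fun n _ => hC n,
          ← ENNReal.ofReal_add (Finset.sum_nonneg fun i _ => hD i) (Finset.sum_nonneg fun n _ => hC n),
          ← ENNReal.ofReal_add (add_nonneg (Finset.sum_nonneg fun i _ => hD i)
            (Finset.sum_nonneg fun n _ => hC n)) (mul_nonneg (s.alpha_pos k).le (by positivity)),
          c.sum_psi_add_sigma, add_div, add_div, Finset.sum_div, Finset.sum_div]
        simp_rw [mul_div_assoc, mul_one_div]

theorem sum_psi_add_sigma_pos (hdof : 0 ≤ c.dof) (k : Fin K) :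
    0 < ∑ i, s.ps i * c.psi i k + c.sigma k := by
  rw [sum_psi_add_sigma]
  exact add_pos_of_nonneg_of_pos (add_nonneg
    (Finset.sum_nonneg fun i _ => mul_nonneg (s.ps_nonneg i) (c.psi_sub_nonneg hdof i k))
    (Finset.sum_nonneg fun n _ => mul_nonneg (s.qs_nonneg n)
      (mul_nonneg (s.vC_nonneg n k) (s.muC_nonneg n k)))) (s.alpha_pos k)

theorem log_one_add_sinrLB_le (hM : mc + md + 1 ≤ M) (k : Fin K) :
    Real.log (1 + c.sinrLB k)
      ≤ ∫ z, Real.log (1 + c.sinr k (s.ofObs z)) ∂obsLaw (M := M) s k := by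
  have hdof := c.dof_nonneg hM
  have hP := s.pilotPowerD_pos k k
  have hS := c.sum_psi_add_sigma_pos hdof k
  have hG0 : 0 ≤ s.ps k * s.vD k k * (s.muD k k / s.pilotPowerD k k) :=
    mul_nonneg (mul_nonneg (s.ps_nonneg k) (s.vD_nonneg k k)) (div_nonneg (s.muD_nonneg k k) hP.le)
  have hLB : c.sinrLB k = s.ps k * s.vD k k * (s.muD k k / s.pilotPowerD k k) *
      (s.pilotPowerD k k * c.dof) / (∑ i, s.ps i * c.psi i k + c.sigma k) := by
    rw [sinrLB, phi]
    congr 1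
    field_simp
  set G := s.ps k * s.vD k k * (s.muD k k / s.pilotPowerD k k) with hG
  have htriv : c.sinrLB k = 0 → Real.log (1 + c.sinrLB k)
      ≤ ∫ z, Real.log (1 + c.sinr k (s.ofObs z)) ∂obsLaw (M := M) s k := by
    intro h
    rw [h, add_zero, Real.log_one]
    refine integral_nonneg fun z => Real.log_nonneg ?_
    have := c.sinr_nonneg k (s.ofObs z)
    linarith
  -- If the signal coefficient or `dof` vanishes, so does `sinrLB`, and a nonnegative SINR suffices.
  -- This covers `M = mc + md + 1`, where the inverse moment bound is unavailable.
  rcases hG0.eq_or_lt with hG1 | hG1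
  · exact htriv (by rw [hLB, ← hG1]; simp)
  rcases hdof.eq_or_lt with hd1 | hd1
  · exact htriv (by rw [hLB, ← hd1]; simp)
  -- Positivity of the integer `dof` supplies the second dimension that the inverse moment needs.
  have hM2 : mc + md + 2 ≤ M := by
    have : ((mc + md + 1 : ℕ) : ℝ) < M := by
      rw [dof] at hd1
      push_cast
      linarith
    exact_mod_cast this
  have hμ : 0 < s.muD k k := by
    refine (s.muD_nonneg k k).lt_of_ne fun h => ?_
    rw [hG, ← h] at hG1
    simp at hG1
  have hy : c.sinrLB k = ((∑ i, s.ps i * c.psi i k + c.sigma k) /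
      (s.pilotPowerD k k * c.dof) / G)⁻¹ := by
    rw [hLB]
    field_simp
  rw [hy]
  refine log_one_add_inv_le_integral (X := fun z => c.interferenceRatio k z / G) (by positivity)
    ((c.measurable_interferenceRatio k).div_const _).aemeasurable ?_ ?_ ?_
    (c.integrable_log_one_add_sinr k)
  · filter_upwards [c.residual_ne_zero_ae hM2 k] with z hw
    exact div_pos (c.interferenceRatio_pos k z hw) hG1
  · filter_upwards [c.residual_ne_zero_ae hM2 k] with z hw
    exact c.sinr_ofObs k z hμ hw
  · simp_rw [ENNReal.ofReal_div_of_pos hG1, div_eq_mul_inv _ (ENNReal.ofReal G)]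
    rw [lintegral_mul_const _ (c.measurable_interferenceRatio k).ennreal_ofReal]
    exact mul_le_mul_left (c.lintegral_interferenceRatio_le hM2 hd1 k) _

end Cancellation

end D2D

end

/-! ### Transfer from the law of the observations to the channel model. -/

theorem mainTheorem2 {N K M τ : ℕ} (s : D2D.System N K M τ) (mc md : ℕ)
    (hM : mc + md + 1 ≤ M) (c : D2D.Cancellation s mc md)
    (T : ℝ) (hT : (τ : ℝ) ≤ T)
    {Ω : Type*} [MeasurableSpace Ω] (P : Measure Ω) [IsProbabilityMeasure P]
    (gD : Fin K → Fin K → Ω → EuclideanSpace ℂ (Fin M))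
    (gC : Fin N → Fin K → Ω → EuclideanSpace ℂ (Fin M))
    (W : Fin K → Ω → Matrix (Fin M) (Fin τ) ℂ)
    (hmodel : ∀ k, D2D.IsChannelModel P s (fun i => gD i k) (fun n => gC n k) (W k)) :
    ∀ k : Fin K,
      Integrable (fun ω => c.rate T k
        (s.receivedPilot k (fun i => gD i k ω) (fun n => gC n k ω) (W k ω))) P ∧
      (1 - τ / T) * Real.logb 2 (1 + c.sinrLB k) ≤
        ∫ ω, c.rate T k
          (s.receivedPilot k (fun i => gD i k ω) (fun n => gC n k ω) (W k ω)) ∂P := by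
  intro k
  have hlaw := (hmodel k).hasLaw_pilotObs k
  set Y := fun ω => s.receivedPilot k (fun i => gD i k ω) (fun n => gC n k ω) (W k ω) with hY
  -- Rebuilding `Y` from its correlations makes the rate a function of the observations, so only
  -- their law matters.
  have hrate : (fun ω => c.rate T k (Y ω)) = fun ω => (1 - τ / T) / Real.log 2 *
      Real.log (1 + c.sinr k (s.ofObs (s.pilotObs (Y ω)))) := by
    funext ω
    rw [s.ofObs_pilotObs, D2D.Cancellation.rate, Real.logb]
    ring
  have hint : Integrable (fun z => Real.log (1 + c.sinr k (s.ofObs z)))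
      (P.map fun ω => s.pilotObs (Y ω)) := by
    rw [hlaw.map_eq]
    exact c.integrable_log_one_add_sinr k
  have hcomp : ∫ ω, Real.log (1 + c.sinr k (s.ofObs (s.pilotObs (Y ω)))) ∂P
      = ∫ z, Real.log (1 + c.sinr k (s.ofObs z)) ∂D2D.Cancellation.obsLaw s k :=
    hlaw.integral_comp (c.integrable_log_one_add_sinr k).aestronglyMeasurable
  have hτ : (0 : ℝ) < τ := by exact_mod_cast (Nat.zero_le N).trans_lt s.N_lt
  have hcoef : 0 ≤ (1 - τ / T) / Real.log 2 :=
    div_nonneg (sub_nonneg.2 ((div_le_one (hτ.trans_le hT)).2 hT)) (Real.log_nonneg one_le_two)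
  refine ⟨?_, ?_⟩
  · change Integrable (fun ω => c.rate T k (Y ω)) P
    rw [hrate]
    exact (hint.comp_aemeasurable hlaw.aemeasurable).const_mul _
  · change _ ≤ ∫ ω, c.rate T k (Y ω) ∂P
    rw [hrate, integral_const_mul, hcomp, Real.logb, mul_div_left_comm, mul_comm]
    exact mul_le_mul_of_nonneg_left (c.log_one_add_sinrLB_le hM k) hcoef
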